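/- Let $M$ be a real analytic manifold of dimension $n$ with a real analytic Lorentzian metric $g$ (of signature $(-+\cdots+)$ or $(+-\cdots-)$), and let $p\in M$. \emph{Types.} In a null frame $(\ell,k,m_i)$ of $T_pM$ ($\ell,k$ null, $g(\ell,k)=1$, the $m_i$ orthogonal to $\ell,k$ and orthonormal up to the overall sign of the metric) the boost weight of a component $T(e_{a_1},\dots,e_{a_r})$ of a covariant tensor $T$ is the number of arguments $\ell$ minus the number of arguments $k$. The Weyl, Ricci or Riemann tensor $T$ at $p$ (the Weyl tensor being zero if $n<3$) is of type N if $T\neq0$ and in some null frame all components of boost weight $>-2$ vanish; of proper type III if in some null frame all components of boost weight $>-1$ vanish, but there is no null frame in which all those of boost weight $>-2$ vanish; of proper type II if in some null frame all components of boost weight $>0$ vanish, there is no null frame in which all those of boost weight $>-1$ vanish, and $T$ is not of type D, that is, there is no null frame in which all components of nonzero boost weight vanish. \emph{Analytic metric extensions.} In an analytic chart of $M$ about $p$, let $U\subseteq\mathbb R^n$ be the coordinate domain, $a\in U$ the coordinates of $p$, and $g_{\mu\nu}$ the components of $g$ on $U$. An analytic metric extension of $g$ with respect to $p$ is a metric $\bar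 g$ obtained as follows: $g^{\mathbb C}_{\mu\nu}$ are holomorphic functions on an open neighbourhood $W\subseteq\mathbb C^n$ of $a$ that agree with $g_{\mu\nu}$ at the points of $W\cap U$; $\iota:\bar U\to W$ is a real analytic imbedding of an open neighbourhood $\bar U$ of $0\in\mathbb R^n$ with $\iota(0)=a$; and $\bar g=\iota^*g^{\mathbb C}$ is real and nondegenerate on $\bar U$. It is an extension to a Riemannian space if $\bar g$ is positive definite on $\bar U$ or negative definite on $\bar U$ (an overall sign of the metric being a matter of convention). \emph{Claim.} If at $p$ the Weyl tensor, the Ricci tensor or the Riemann tensor of $g$ is of type N, of proper type III or of proper type II, then there is no analytic metric extension of $g$ with respect to $p$, in any analytic chart about $p$, to a Riemannian space. -/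

import Mathlib

open scoped Manifold ContDiff

noncomputable section

namespace Spacetime

/-! ### Curvature of a metric given in coordinates

`g x i j` is the component `g_{ij}` at the point with coordinates `x`. The definitions are made over
`ℝ` and over `ℂ` at once. -/

section Curvature

variable {𝕜 : Type*} [RCLike 𝕜] {n : ℕ}

/-- The partial derivative `∂_i f` at `x`. -/
def pderiv (i : Fin n) (f : (Fin n → 𝕜) → 𝕜) (x : Fin n → 𝕜) : 𝕜 :=
  fderiv 𝕜 f x (Pi.single i 1)

/-- The Christoffel symbol `Γ^k_{ij} = ½ g^{kl} (∂_i g_{jl} + ∂_j g_{il} - ∂_l g_{ij})`. -/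
def christoffel (g : (Fin n → 𝕜) → Matrix (Fin n) (Fin n) 𝕜) (k i j : Fin n)
    (x : Fin n → 𝕜) : 𝕜 :=
  2⁻¹ * ∑ l, (g x)⁻¹ k l *
    (pderiv i (fun y => g y j l) x + pderiv j (fun y => g y i l) x - pderiv l (fun y => g y i j) x)

/-- The curvature tensor
`R^a_{bcd} = ∂_c Γ^a_{db} - ∂_d Γ^a_{cb} + Γ^a_{ce} Γ^e_{db} - Γ^a_{de} Γ^e_{cb}`. -/
def riemannUp (g : (Fin n → 𝕜) → Matrix (Fin n) (Fin n) 𝕜) (x : Fin n → 𝕜)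
    (a b c d : Fin n) : 𝕜 :=
  pderiv c (christoffel g a d b) x - pderiv d (christoffel g a c b) x
    + ∑ e, (christoffel g a c e x * christoffel g e d b x
        - christoffel g a d e x * christoffel g e c b x)

/-- The Riemann tensor `R_{abcd} = g_{ae} R^e_{bcd}`. -/
def riemann (g : (Fin n → 𝕜) → Matrix (Fin n) (Fin n) 𝕜) (x : Fin n → 𝕜)
    (a b c d : Fin n) : 𝕜 :=
  ∑ e, g x a e * riemannUp g x e b c d

/-- The Ricci tensor `R_{bd} = R^a_{bad}`. -/
def ricci (g : (Fin n → 𝕜) → Matrix (Fin n) (Fin n) 𝕜) (x : Fin n → 𝕜) (b d : Fin n) : 𝕜 :=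
  ∑ a, riemannUp g x a b a d

/-- The Ricci scalar `R = g^{bd} R_{bd}`. -/
def ricciScalar (g : (Fin n → 𝕜) → Matrix (Fin n) (Fin n) 𝕜) (x : Fin n → 𝕜) : 𝕜 :=
  ∑ b, ∑ d, (g x)⁻¹ b d * ricci g x b d

/-- The Weyl tensor `C_{abcd}`, the totally trace-free part of the Riemann tensor. It is zero in
dimensions below three. -/
def weyl (g : (Fin n → 𝕜) → Matrix (Fin n) (Fin n) 𝕜) (x : Fin n → 𝕜) (a b c d : Fin n) : 𝕜 :=
  if n < 3 then 0 else
    riemann g x a b c d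
      - ((n : 𝕜) - 2)⁻¹ * (g x a c * ricci g x b d - g x a d * ricci g x b c
          + g x b d * ricci g x a c - g x b c * ricci g x a d)
      + (((n : 𝕜) - 1) * ((n : 𝕜) - 2))⁻¹ * ricciScalar g x
          * (g x a c * g x b d - g x a d * g x b c)

end Curvature

/-! ### Boost weights and alignment types of a tensor at a point -/

section Alignment

variable {n k : ℕ}

/-- The component `T (e_{I 0}, …, e_{I (k-1)})` in the frame `e` of the covariant tensor of rank `k`
with coordinate components `T`. -/
def frameComponent (T : (Fin k → Fin n) → ℝ) (e : Fin n → Fin n → ℝ) (I : Fin k → Fin n) : ℝ :=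
  ∑ J : Fin k → Fin n, (∏ r, e (I r) (J r)) * T J

/-- A null frame for the inner product with Gram matrix `G`: the vectors `ℓ = e o` and `k = e o'`
are null with `⟨ℓ, k⟩ = 1`, and the other vectors of the frame are orthogonal to both and
orthonormal, up to the overall sign `ε` of the metric. -/
structure IsNullFrame (G : Matrix (Fin n) (Fin n) ℝ) (e : Fin n → Fin n → ℝ) (o o' : Fin n) :
    Prop where
  ne : o ≠ o'
  null_left : e o ⬝ᵥ G.mulVec (e o) = 0
  null_right : e o' ⬝ᵥ G.mulVec (e o') = 0
  pairing : e o ⬝ᵥ G.mulVec (e o') = 1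
  transverse : ∀ i, i ≠ o → i ≠ o' →
    e o ⬝ᵥ G.mulVec (e i) = 0 ∧ e o' ⬝ᵥ G.mulVec (e i) = 0
  orthonormal : ∃ ε : ℝ, (ε = 1 ∨ ε = -1) ∧ ∀ i j, i ≠ o → i ≠ o' → j ≠ o → j ≠ o' →
    e i ⬝ᵥ G.mulVec (e j) = if i = j then ε else 0

/-- The boost weight of the frame component with indices `I`: the component is multiplied by
`λ ^ boostWeight o o' I` under the boost `ℓ ↦ λ ℓ`, `k ↦ λ⁻¹ k`. -/
def boostWeight (o o' : Fin n) (I : Fin k → Fin n) : ℤ :=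
  ∑ r, (if I r = o then 1 else if I r = o' then -1 else 0)

/-- Some null frame gives `T` boost order at most `b`: all components of boost weight greater
than `b` vanish. -/
def BoostOrderLE (G : Matrix (Fin n) (Fin n) ℝ) (T : (Fin k → Fin n) → ℝ) (b : ℤ) : Prop :=
  ∃ e o o', IsNullFrame G e o o' ∧
    ∀ I, b < boostWeight o o' I → frameComponent T e I = 0

/-- In some null frame all components of nonzero boost weight vanish. -/
def OnlyBoostWeightZero (G : Matrix (Fin n) (Fin n) ℝ) (T : (Fin k → Fin n) → ℝ) : Prop :=
  ∃ e o o', IsNullFrame G e o o' ∧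
    ∀ I, boostWeight o o' I ≠ 0 → frameComponent T e I = 0

/-- Type N: nonzero, with components of boost weight `-2` only. (The Weyl, Ricci and Riemann tensors
have no components of boost weight less than `-2`.) -/
def IsTypeN (G : Matrix (Fin n) (Fin n) ℝ) (T : (Fin k → Fin n) → ℝ) : Prop :=
  T ≠ 0 ∧ BoostOrderLE G T (-2)

/-- Proper type III: components of negative boost weight only, but not type N or zero. -/
def IsTypeIII (G : Matrix (Fin n) (Fin n) ℝ) (T : (Fin k → Fin n) → ℝ) : Prop :=
  BoostOrderLE G T (-1) ∧ ¬ BoostOrderLE G T (-2)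

/-- Type D: type II with all components of nonzero boost weight vanishing in some null frame. -/
def IsTypeD (G : Matrix (Fin n) (Fin n) ℝ) (T : (Fin k → Fin n) → ℝ) : Prop :=
  BoostOrderLE G T 0 ∧ ¬ BoostOrderLE G T (-1) ∧ OnlyBoostWeightZero G T

/-- Proper type II: no components of positive boost weight, but not of type III, N or D, or zero. -/
def IsTypeII (G : Matrix (Fin n) (Fin n) ℝ) (T : (Fin k → Fin n) → ℝ) : Prop :=
  BoostOrderLE G T 0 ∧ ¬ BoostOrderLE G T (-1) ∧ ¬ IsTypeD G T

/-- Proper type N, III or II. -/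
def IsProperlySpecial (G : Matrix (Fin n) (Fin n) ℝ) (T : (Fin k → Fin n) → ℝ) : Prop :=
  IsTypeN G T ∨ IsTypeIII G T ∨ IsTypeII G T

end Alignment

/-! ### Analytic metric extensions in coordinates -/

section Extension

variable {n : ℕ}

/-- The real point `x` as a point of `ℂⁿ`. -/
def toComplex (x : Fin n → ℝ) : Fin n → ℂ := fun i => (x i : ℂ)

/-- `gC` is a holomorphic extension of the metric `g`, given on `U ⊆ ℝⁿ`, to the open neighbourhood
`W ⊆ ℂⁿ` of the point `a`. -/
structure IsComplexification (U : Set (Fin n → ℝ))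
    (g : (Fin n → ℝ) → Matrix (Fin n) (Fin n) ℝ) (a : Fin n → ℝ)
    (W : Set (Fin n → ℂ)) (gC : (Fin n → ℂ) → Matrix (Fin n) (Fin n) ℂ) : Prop where
  isOpen : IsOpen W
  mem : toComplex a ∈ W
  holomorphic : ∀ i j, AnalyticOnNhd ℂ (fun z => gC z i j) W
  extends_real : ∀ x ∈ U, toComplex x ∈ W → ∀ i j, gC (toComplex x) i j = (g x i j : ℂ)

/-- `ι`, defined on the open neighbourhood `V` of `0 ∈ ℝⁿ`, is the imbedding of an `n`-dimensional
real analytic submanifold of `W ⊆ ℂⁿ` through the point `a`. -/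
structure IsRealSlice (a : Fin n → ℝ) (W : Set (Fin n → ℂ))
    (V : Set (Fin n → ℝ)) (ι : (Fin n → ℝ) → Fin n → ℂ) : Prop where
  isOpen : IsOpen V
  zero_mem : 0 ∈ V
  analytic : AnalyticOnNhd ℝ ι V
  mapsTo : Set.MapsTo ι V W
  map_zero : ι 0 = toComplex a
  isEmbedding : Topology.IsEmbedding (V.domRestrict ι)
  immersion : ∀ y ∈ V, Function.Injective (fderiv ℝ ι y)

/-- The pulled back form `(ι^* gC)_{ij} = ∂_i ι^a ∂_j ι^b gC_{ab}`. -/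
def pullback (gC : (Fin n → ℂ) → Matrix (Fin n) (Fin n) ℂ) (ι : (Fin n → ℝ) → Fin n → ℂ)
    (y : Fin n → ℝ) : Matrix (Fin n) (Fin n) ℂ :=
  fun i j => ∑ a, ∑ b,
    fderiv ℝ ι y (Pi.single i 1) a * fderiv ℝ ι y (Pi.single j 1) b * gC (ι y) a b

/-- `gbar` on `V` is an analytic metric extension, with respect to the point `a`, of the metric `g`
on `U`: it is the pullback of a complexification of `g` to a real slice through `a`, and it is real
and nondegenerate. -/
def IsAnalyticMetricExtension (U : Set (Fin n → ℝ))
    (g : (Fin n → ℝ) → Matrix (Fin n) (Fin n) ℝ) (a : Fin n → ℝ)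
    (V : Set (Fin n → ℝ)) (gbar : (Fin n → ℝ) → Matrix (Fin n) (Fin n) ℝ) : Prop :=
  ∃ W gC ι, IsComplexification U g a W gC ∧ IsRealSlice a W V ι ∧
    (∀ y ∈ V, ∀ i j, (gbar y i j : ℂ) = pullback gC ι y i j) ∧
    ∀ y ∈ V, (gbar y).det ≠ 0

/-- The metric `gbar` on `V` is Riemannian; an overall change of sign of a metric is a matter of
convention, so that both definite signatures `(+ ⋯ +)` and `(- ⋯ -)` count. -/
def IsRiemannianOn (V : Set (Fin n → ℝ)) (gbar : (Fin n → ℝ) → Matrix (Fin n) (Fin n) ℝ) : Prop :=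
  (∀ y ∈ V, (gbar y).PosDef) ∨ (∀ y ∈ V, (-gbar y).PosDef)

end Extension

/-! ### Analytic metrics on manifolds -/

section Manifold

variable {n : ℕ} {M : Type*} [TopologicalSpace M] [ChartedSpace (Fin n → ℝ) M]

/-- The components `g_{ij}(x) = g (∂_i, ∂_j)` of a field of bilinear forms in the chart `φ`, as
functions on `φ.target`. -/
def chartComponents
    (form : ∀ p : M, TangentSpace 𝓘(ℝ, Fin n → ℝ) p →ₗ[ℝ] TangentSpace 𝓘(ℝ, Fin n → ℝ) p →ₗ[ℝ] ℝ)
    (φ : OpenPartialHomeomorph M (Fin n → ℝ)) (x : Fin n → ℝ) : Matrix (Fin n) (Fin n) ℝ :=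
  fun i j => form (φ.symm x)
    (mfderiv 𝓘(ℝ, Fin n → ℝ) 𝓘(ℝ, Fin n → ℝ) φ.symm x (Pi.single i (1 : ℝ) : Fin n → ℝ))
    (mfderiv 𝓘(ℝ, Fin n → ℝ) 𝓘(ℝ, Fin n → ℝ) φ.symm x (Pi.single j (1 : ℝ) : Fin n → ℝ))

variable (n M) in
/-- A real analytic Lorentzian metric on a real analytic manifold of dimension `n`. Both conventions
`(- + ⋯ +)` and `(+ - ⋯ -)` are allowed. -/
structure LorentzianMetric where
  form : ∀ p : M,
    TangentSpace 𝓘(ℝ, Fin n → ℝ) p →ₗ[ℝ] TangentSpace 𝓘(ℝ, Fin n → ℝ) p →ₗ[ℝ] ℝ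
  lorentzian : ∀ p : M, ∃ (b : Module.Basis (Fin n) ℝ (TangentSpace 𝓘(ℝ, Fin n → ℝ) p))
    (i₀ : Fin n) (ε : ℝ), (ε = 1 ∨ ε = -1) ∧
      ∀ i j, form p (b i) (b j) = if i = j then (if i = i₀ then -ε else ε) else 0
  analytic : ∀ φ ∈ IsManifold.maximalAtlas 𝓘(ℝ, Fin n → ℝ) ω M, ∀ i j,
    AnalyticOnNhd ℝ (fun x => chartComponents form φ x i j) φ.target

namespace LorentzianMetric

/-- The components of the metric in the chart `φ`. -/
def inChart (g : LorentzianMetric n M) (φ : OpenPartialHomeomorph M (Fin n → ℝ)) :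
    (Fin n → ℝ) → Matrix (Fin n) (Fin n) ℝ :=
  chartComponents g.form φ

/-- The Weyl tensor at `p` is of proper type N, III or II. The condition is tensorial, so that it
does not matter in which analytic chart about `p` it is read. -/
def IsWeylSpecialAt (g : LorentzianMetric n M) (p : M) : Prop :=
  ∃ φ ∈ IsManifold.maximalAtlas 𝓘(ℝ, Fin n → ℝ) ω M, p ∈ φ.source ∧
    IsProperlySpecial (g.inChart φ (φ p))
      (fun I : Fin 4 → Fin n => weyl (g.inChart φ) (φ p) (I 0) (I 1) (I 2) (I 3))

/-- The Ricci tensor at `p` is of proper type N, III or II. -/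
def IsRicciSpecialAt (g : LorentzianMetric n M) (p : M) : Prop :=
  ∃ φ ∈ IsManifold.maximalAtlas 𝓘(ℝ, Fin n → ℝ) ω M, p ∈ φ.source ∧
    IsProperlySpecial (g.inChart φ (φ p))
      (fun I : Fin 2 → Fin n => ricci (g.inChart φ) (φ p) (I 0) (I 1))

/-- The Riemann tensor at `p` is of proper type N, III or II. -/
def IsRiemannSpecialAt (g : LorentzianMetric n M) (p : M) : Prop :=
  ∃ φ ∈ IsManifold.maximalAtlas 𝓘(ℝ, Fin n → ℝ) ω M, p ∈ φ.source ∧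
    IsProperlySpecial (g.inChart φ (φ p))
      (fun I : Fin 4 → Fin n => riemann (g.inChart φ) (φ p) (I 0) (I 1) (I 2) (I 3))

/-- There is an analytic metric extension of `g` with respect to `p`, in some analytic chart
about `p`, to a Riemannian metric. -/
def HasRiemannianExtensionAt (g : LorentzianMetric n M) (p : M) : Prop :=
  ∃ φ ∈ IsManifold.maximalAtlas 𝓘(ℝ, Fin n → ℝ) ω M, p ∈ φ.source ∧
    ∃ V gbar, IsAnalyticMetricExtension φ.target (g.inChart φ) (φ p) V gbar ∧
      IsRiemannianOn V gbar

end LorentzianMetric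

end Manifold

end Spacetime

end

/-! Both metrics are restrictions of one holomorphic metric, and the two real slices pass through
the same point, so their tangent spaces there are two real forms of a single complex quadratic
space. By the transformation law of the curvature (`IsPullbackMetric.curvature_pullback` and its
consequences for Riemann, Ricci and Weyl) the curvature tensors of the two slices are restrictions
of the same complex multilinear form. What remains is algebra, `not_isProperlySpecial`: a tensor
that is real on a Lorentzian and on a definite real form cannot be properly special.

Let σ be the conjugation fixing the definite form, and suppose the components of boost weight above
b vanish in a real null frame with first vector ℓ. Definiteness gives B(ℓ, σℓ) ≠ 0, so q = σℓ / B(ℓ,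
σℓ) completes ℓ to a complex null frame. The bound depends on ℓ alone (`changeRight_component`),
hence survives. As σ exchanges the lines of ℓ and q and preserves their orthogonal complement, it
reverses boost weights, so the components of weight below -b vanish too (`exists_symmetric_frame`).

If b ≤ -1, no component is left and the tensor is zero, which excludes types N and III. If b = 0,
only weight zero is left, but q is complex. Having weight zero only amounts to being annihilated by
the infinitesimal boost of ℓ and q, a condition linear in q (`boostAction_eq_zero`,
`boostAction_frame`). Since ℓ and the tensor are real, Re q satisfies it as well, and so does the
real null vector obtained from Re q by adding a multiple of ℓ. This real null frame rules out proper
type II. -/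

noncomputable section

namespace Spacetime

/-! ### Multilinear forms and their components -/

section MultilinearAlgebra

variable {K : Type*} [Field K] {n k : ℕ}

/-- The multilinear form with coordinate components `T`. -/
def tensorMap (T : (Fin k → Fin n) → K) :
    MultilinearMap K (fun _ : Fin k => Fin n → K) K :=
  ∑ J, T J • (MultilinearMap.mkPiAlgebra K (Fin k) K).compLinearMap
    (fun r => LinearMap.proj (J r))

theorem tensorMap_apply (T : (Fin k → Fin n) → K) (v : Fin k → Fin n → K) :
    tensorMap T v = ∑ J : Fin k → Fin n, (∏ r, v r (J r)) * T J := by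
  simp [tensorMap, mul_comm]

theorem tensorMap_single (T : (Fin k → Fin n) → K) (I : Fin k → Fin n) :
    tensorMap T (fun r => Pi.single (I r) 1) = T I := by
  rw [tensorMap_apply, Finset.sum_eq_single I]
  · simp
  · intro J _ hJ
    obtain ⟨r, hr⟩ := Function.ne_iff.1 hJ
    rw [Finset.prod_eq_zero (Finset.mem_univ r) (by simp [hr]), zero_mul]
  · simp

theorem frameComponent_eq_tensorMap (T : (Fin k → Fin n) → ℝ) (e : Fin n → Fin n → ℝ)
    (I : Fin k → Fin n) : frameComponent T e I = tensorMap T (fun r => e (I r)) := by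
  rw [tensorMap_apply, frameComponent]

/-- Two multilinear forms agree once they agree on the standard basis vectors. -/
theorem multilinear_ext_single {f g : MultilinearMap K (fun _ : Fin k => Fin n → K) K}
    (h : ∀ I : Fin k → Fin n, f (fun r => Pi.single (I r) 1) = g (fun r => Pi.single (I r) 1)) :
    f = g := by
  refine Module.Basis.ext_multilinear (fun _ => Pi.basisFun K (Fin n)) fun I => ?_
  simpa using h I

/-- If `S` has the components of `T` in the images of the basis vectors under `J`, then `S` is the
pullback of `T` by `J`. -/
theorem tensorMap_pullback {S T : (Fin k → Fin n) → K} {J : Matrix (Fin n) (Fin n) K}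
    (h : ∀ I, S I = tensorMap T (fun r => J.mulVec (Pi.single (I r) 1)))
    (v : Fin k → Fin n → K) : tensorMap S v = tensorMap T (fun r => J.mulVec (v r)) := by
  have : tensorMap S = (tensorMap T).compLinearMap (fun _ => J.mulVecLin) := by
    refine multilinear_ext_single fun I => ?_
    rw [tensorMap_single, h]
    rfl
  rw [this]
  rfl

variable {V : Type*} [AddCommGroup V] [Module K V]

/-- Only the frame components whose coefficients are all nonzero survive the multilinear expansion.
All later vanishing arguments reduce to locating these nonzero coefficients. -/
theorem map_eq_zero_of_expansion (f : MultilinearMap K (fun _ : Fin k => V) K) (e : Fin n → V)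
    (v : Fin k → V) (P : Fin k → Fin n → K) (hv : ∀ r, v r = ∑ j, P r j • e j)
    (h : ∀ J : Fin k → Fin n, (∀ r, P r (J r) ≠ 0) → f (fun r => e (J r)) = 0) : f v = 0 := by
  rw [funext hv, MultilinearMap.map_sum]
  refine Finset.sum_eq_zero fun J _ => ?_
  rw [MultilinearMap.map_smul_univ]
  by_cases hJ : ∀ r, P r (J r) ≠ 0
  · rw [h J hJ, smul_zero]
  · push Not at hJ
    obtain ⟨r, hr⟩ := hJ
    rw [Finset.prod_eq_zero (Finset.mem_univ r) hr, zero_smul]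

end MultilinearAlgebra

/-! ### Null frames, null rotations and boosts over a field -/

section NullFrames

variable {n k : ℕ}

/-- The boost weight of the frame vector with index `i`. -/
def weight (o o' i : Fin n) : ℤ := if i = o then 1 else if i = o' then -1 else 0

theorem boostWeight_eq_sum (o o' : Fin n) (I : Fin k → Fin n) :
    boostWeight o o' I = ∑ r, weight o o' (I r) := rfl

variable {K : Type*} [Field K] {V : Type*} [AddCommGroup V] [Module K V]

/-- The frame `e` is null with respect to the bilinear form `B`: the index dual to `i` is `i` with
`o` and `o'` interchanged, and `s i` is the product of `e i` with its dual vector. -/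
structure IsDualFrame (B : V →ₗ[K] V →ₗ[K] K) (e : Fin n → V) (o o' : Fin n) (s : Fin n → K) :
    Prop where
  ne : o ≠ o'
  pair : ∀ i j, B (e i) (e (Equiv.swap o o' j)) = if i = j then s i else 0
  sign_left : s o = 1
  sign_right : s o' = 1
  sign_sq : ∀ i, s i * s i = 1

namespace IsDualFrame

variable {B : V →ₗ[K] V →ₗ[K] K} {e : Fin n → V} {o o' : Fin n} {s : Fin n → K}

theorem pair_left (h : IsDualFrame B e o o' s) (i : Fin n) :
    B (e i) (e o) = if i = o' then 1 else 0 := by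
  have := h.pair i o'
  rw [Equiv.swap_apply_right] at this
  rw [this]
  split_ifs with hi
  · rw [hi, h.sign_right]
  · rfl

theorem pair_right (h : IsDualFrame B e o o' s) (i : Fin n) :
    B (e i) (e o') = if i = o then 1 else 0 := by
  have := h.pair i o
  rw [Equiv.swap_apply_left] at this
  rw [this]
  split_ifs with hi
  · rw [hi, h.sign_left]
  · rfl

theorem pair_transverse (h : IsDualFrame B e o o' s) (i j : Fin n) (hj : j ≠ o) (hj' : j ≠ o') :
    B (e i) (e j) = if i = j then s i else 0 := by
  have := h.pair i j
  rwa [Equiv.swap_apply_of_ne_of_ne hj hj'] at this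

theorem sign_ne_zero (h : IsDualFrame B e o o' s) (i : Fin n) : s i ≠ 0 := fun h0 => by
  have := h.sign_sq i
  simp [h0] at this

theorem linearIndependent (h : IsDualFrame B e o o' s) : LinearIndependent K e := by
  rw [Fintype.linearIndependent_iff]
  intro c hc j
  have : B (∑ i, c i • e i) (e (Equiv.swap o o' j)) = 0 := by rw [hc]; simp
  simpa [map_sum, LinearMap.sum_apply, h.pair, h.sign_ne_zero j] using this

/-- The expansion of a vector in a null frame. -/
theorem expansion [FiniteDimensional K V] (h : IsDualFrame B e o o' s)
    (hn : Module.finrank K V = n) (v : V) :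
    v = ∑ j, (s j * B v (e (Equiv.swap o o' j))) • e j := by
  have : Nonempty (Fin n) := ⟨o⟩
  have hspan := h.linearIndependent.span_eq_top_of_card_eq_finrank (by simp [hn])
  have hv : v ∈ Submodule.span K (Set.range e) := hspan ▸ Submodule.mem_top
  obtain ⟨c, rfl⟩ := (Submodule.mem_span_range_iff_exists_fun K).1 hv
  refine Finset.sum_congr rfl fun j _ => ?_
  congr 1
  simp only [map_sum, LinearMap.sum_apply, map_smul, LinearMap.smul_apply, h.pair, smul_eq_mul,
    mul_ite, mul_zero, Finset.sum_ite_eq', Finset.mem_univ, if_true]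
  rw [mul_left_comm, h.sign_sq, mul_one]

/-- The null frame obtained by replacing the second null vector by `q`. -/
def changeRight (B : V →ₗ[K] V →ₗ[K] K) (e : Fin n → V) (o o' : Fin n) (q : V) (i : Fin n) : V :=
  if i = o then e o else if i = o' then q else e i - B (e i) q • e o

/-- A null rotation about `e o`: subtracting `B (e i) q • e o` makes a transverse vector orthogonal
to `q`, and leaves the transverse products alone because `e o` is null and orthogonal to all
transverse vectors. -/
theorem changeRight_isDualFrame (h : IsDualFrame B e o o' s) (hB : ∀ v w, B v w = B w v) {q : V}
    (hq : B q q = 0) (hlq : B (e o) q = 1) :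
    IsDualFrame B (changeRight B e o o' q) o o' s := by
  have hoo : B (e o) (e o) = 0 := by simp [h.pair_left, h.ne]
  have hql : B q (e o) = 1 := by rw [hB, hlq]
  have hne' := h.ne.symm
  have hne := h.ne
  refine ⟨h.ne, fun i j => ?_, h.sign_left, h.sign_right, h.sign_sq⟩
  have hio : ∀ i, i ≠ o → i ≠ o' → B (e i) (e o) = 0 := fun i _ hi => by simp [h.pair_left, hi]
  have hoi : ∀ i, i ≠ o → i ≠ o' → B (e o) (e i) = 0 := fun i h1 h2 => by rw [hB, hio i h1 h2]
  by_cases hj : j = o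
  · subst hj
    rw [Equiv.swap_apply_left]
    by_cases hi : i = j
    · subst hi
      simp [changeRight, hne', hlq, h.sign_left]
    · by_cases hi' : i = o'
      · subst hi'
        simp [changeRight, hne', hq]
      · simp [changeRight, hi, hi', hne', hlq]
  by_cases hj' : j = o'
  · subst hj'
    rw [Equiv.swap_apply_right]
    by_cases hi : i = o
    · subst hi
      simp [changeRight, hoo, hne]
    · by_cases hi' : i = j
      · subst hi'
        simp [changeRight, hne', hql, h.sign_right]
      · simp [changeRight, hi, hi', hoo, hio]
  rw [Equiv.swap_apply_of_ne_of_ne hj hj']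
  by_cases hi : i = o
  · subst hi
    simp [changeRight, hj, hj', hoo, hoi, Ne.symm hj]
  · by_cases hi' : i = o'
    · subst hi'
      simp [changeRight, hj, hj', hql, hne', Ne.symm hj', hB q (e j)]
    · simp [changeRight, hi, hi', hj, hj', hoo, hoi, hio, h.pair_transverse]

end IsDualFrame

/-- The boost order depends on the first null vector of the frame only. -/
theorem changeRight_component [FiniteDimensional K V] {B : V →ₗ[K] V →ₗ[K] K} {e : Fin n → V}
    {o o' : Fin n} {s : Fin n → K} (h : IsDualFrame B e o o' s) (hn : Module.finrank K V = n)
    (f : MultilinearMap K (fun _ : Fin k => V) K) {b : ℤ}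
    (hf : ∀ I : Fin k → Fin n, b < boostWeight o o' I → f (fun r => e (I r)) = 0) (q : V)
    (I : Fin k → Fin n) (hI : b < boostWeight o o' I) :
    f (fun r => IsDualFrame.changeRight B e o o' q (I r)) = 0 := by
  -- The change of frame never lowers weights: the first null vector is kept, a transverse vector
  -- acquires only a multiple of it, and the second null vector already has the least weight -1, so
  -- `q` may have arbitrary components.
  have hP : ∀ i, ∃ P : Fin n → K, IsDualFrame.changeRight B e o o' q i = ∑ j, P j • e j ∧
      ∀ j, P j ≠ 0 → weight o o' i ≤ weight o o' j := by
    intro i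
    by_cases hi : i = o
    · refine ⟨Pi.single o 1, ?_, fun j hj => ?_⟩
      · simp [IsDualFrame.changeRight, hi, Pi.single_apply]
      · have : j = o := by
          by_contra hjo
          simp [hjo] at hj
        rw [hi, this]
    by_cases hi' : i = o'
    · refine ⟨_, by rw [← h.expansion hn], fun j _ => ?_⟩
      subst hi'
      simp only [weight, if_neg hi, if_true]
      split_ifs <;> simp
    · refine ⟨Pi.single i 1 - Pi.single o (B (e i) q), ?_, fun j hj => ?_⟩
      · simp [IsDualFrame.changeRight, hi, hi', Pi.single_apply, sub_smul]
      · have : j = o ∨ j = i := by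
          by_contra! hjo
          simp [hjo.1, hjo.2] at hj
        rcases this with rfl | rfl
        · simp [weight, hi, hi']
        · exact le_rfl
  choose P hP1 hP2 using hP
  refine map_eq_zero_of_expansion f e _ (fun r => P (I r)) (fun r => hP1 _) fun J hJ => hf J ?_
  refine hI.trans_le ?_
  rw [boostWeight_eq_sum, boostWeight_eq_sum]
  exact Finset.sum_le_sum fun r _ => hP2 _ _ (hJ r)

theorem weight_swap (o o' j : Fin n) (h : o ≠ o') :
    weight o o' (Equiv.swap o o' j) = - weight o o' j := by
  by_cases hj : j = o
  · subst hj; simp [weight, h.symm]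
  · by_cases hj' : j = o'
    · subst hj'; simp [weight, h.symm]
    · rw [Equiv.swap_apply_of_ne_of_ne hj hj']; simp [weight, hj, hj']

/-- The infinitesimal boost with null directions `l` and `q`. -/
def boost (B : V →ₗ[K] V →ₗ[K] K) (l q : V) (v : V) : V := B v q • l - B v l • q

theorem boost_frame {B : V →ₗ[K] V →ₗ[K] K} {e : Fin n → V}
    {o o' : Fin n} {s : Fin n → K} (h : IsDualFrame B e o o' s) (i : Fin n) :
    boost B (e o) (e o') (e i) = (weight o o' i : K) • e i := by
  rw [boost, h.pair_left, h.pair_right, weight]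
  have := h.ne
  by_cases hi : i = o
  · subst hi
    simp [this]
  · by_cases hi' : i = o'
    · subst hi'
      simp [this.symm]
    · simp [hi, hi']

/-- The action of the infinitesimal boost on a multilinear form. -/
def boostAction (B : V →ₗ[K] V →ₗ[K] K) (l q : V) (f : MultilinearMap K (fun _ : Fin k => V) K)
    (v : Fin k → V) : K :=
  ∑ r, f (Function.update v r (boost B l q (v r)))

/-- Frame vectors are eigenvectors of the boost, with their weights as eigenvalues. In
characteristic zero an invariant form therefore has components of weight zero only. -/
theorem boostAction_frame {B : V →ₗ[K] V →ₗ[K] K} {e : Fin n → V}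
    {o o' : Fin n} {s : Fin n → K} (h : IsDualFrame B e o o' s)
    (f : MultilinearMap K (fun _ : Fin k => V) K) (I : Fin k → Fin n) :
    boostAction B (e o) (e o') f (fun r => e (I r))
      = (boostWeight o o' I : K) * f (fun r => e (I r)) := by
  rw [boostAction, boostWeight_eq_sum, Int.cast_sum, Finset.sum_mul]
  refine Finset.sum_congr rfl fun r _ => ?_
  rw [boost_frame h, MultilinearMap.map_update_smul]
  simp [Function.update_eq_self]

/-- A form all of whose components have boost weight zero is invariant under the boost. -/
theorem boostAction_eq_zero [FiniteDimensional K V] {B : V →ₗ[K] V →ₗ[K] K} {e : Fin n → V}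
    {o o' : Fin n} {s : Fin n → K} (h : IsDualFrame B e o o' s) (hn : Module.finrank K V = n)
    (f : MultilinearMap K (fun _ : Fin k => V) K)
    (hf : ∀ I : Fin k → Fin n, boostWeight o o' I ≠ 0 → f (fun r => e (I r)) = 0)
    (v : Fin k → V) : boostAction B (e o) (e o') f v = 0 := by
  let D : V →ₗ[K] V := (B.flip (e o')).smulRight (e o) - (B.flip (e o)).smulRight (e o')
  have hD : ∀ w, D w = boost B (e o) (e o') w := fun w => rfl
  -- The action on `f` is itself multilinear in the arguments, so its vanishing can be tested on
  -- frame vectors.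
  let F : MultilinearMap K (fun _ : Fin k => V) K :=
    ∑ r, f.compLinearMap (Function.update (fun _ => LinearMap.id) r D)
  have hF : ∀ v, F v = boostAction B (e o) (e o') f v := by
    intro v
    simp only [F, sum_apply, boostAction]
    refine Finset.sum_congr rfl fun r _ => ?_
    rw [MultilinearMap.compLinearMap_apply]
    congr 1
    ext i
    by_cases hi : i = r
    · subst hi; simp [hD]
    · simp [hi]
  rw [← hF]
  refine map_eq_zero_of_expansion F e v (fun r j => s j * B (v r) (e (Equiv.swap o o' j)))
    (fun r => h.expansion hn _) fun J _ => ?_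
  rw [hF, boostAction_frame h]
  by_cases hJ : boostWeight o o' J = 0
  · simp [hJ]
  · rw [hf J hJ, mul_zero]

end NullFrames

/-! ### The effect of a definite real structure on boost weights -/

section RealStructures

variable {n k : ℕ} {V : Type*} [AddCommGroup V] [Module ℂ V] [FiniteDimensional ℂ V]

/-- Let `σ` be a real structure that is compatible with `B` and `f` and such that the hermitian form
`B v (σ v)` is anisotropic. Then `q = σ l / B l (σ l)` is a null vector such that in the
null frame with null vectors `l` and `q` the components of `f` are subject to the mirror image of the
bound on their boost weights. -/
theorem exists_symmetric_frame {B : V →ₗ[ℂ] V →ₗ[ℂ] ℂ} {e : Fin n → V} {o o' : Fin n}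
    {s : Fin n → ℂ} (h : IsDualFrame B e o o' s) (hn : Module.finrank ℂ V = n)
    (hB : ∀ v w, B v w = B w v) (f : MultilinearMap ℂ (fun _ : Fin k => V) ℂ) {b : ℤ}
    (hf : ∀ I : Fin k → Fin n, b < boostWeight o o' I → f (fun r => e (I r)) = 0)
    (σ : V →ₗ⋆[ℂ] V) (hσσ : ∀ v, σ (σ v) = v) (hσB : ∀ v w, B (σ v) (σ w) = star (B v w))
    (hσf : ∀ v : Fin k → V, f (fun r => σ (v r)) = star (f v))
    (hσ : ∀ v, B v (σ v) = 0 → v = 0) :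
    ∃ e', IsDualFrame B e' o o' s ∧ e' o = e o ∧
      ∀ I : Fin k → Fin n, (b < boostWeight o o' I ∨ boostWeight o o' I < -b) →
        f (fun r => e' (I r)) = 0 := by
  set l := e o with hl
  set c := B l (σ l) with hc
  -- This is where definiteness enters: `l` is nonzero, since its product with `e o'` is 1, so
  -- anisotropy keeps it from being orthogonal to `σ l`.
  have hc0 : c ≠ 0 := fun hc0 => by
    have := hσ _ hc0
    have h1 := h.pair_right o
    rw [← hl, this] at h1
    simp at h1
  have hll : B l l = 0 := by rw [hl, h.pair_left]; simp [h.ne]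
  set q := c⁻¹ • σ l with hq
  have hqq : B q q = 0 := by
    rw [hq, map_smul, map_smul, LinearMap.smul_apply, hσB, hll]; simp
  have hlq : B l q = 1 := by
    rw [hq, map_smul, ← hc, smul_eq_mul, inv_mul_cancel₀ hc0]
  set e' := IsDualFrame.changeRight B e o o' q with he'
  have h' : IsDualFrame B e' o o' s := h.changeRight_isDualFrame hB hqq hlq
  have he'o : e' o = l := by simp [he', IsDualFrame.changeRight, hl]
  have he'o' : e' o' = q := by simp [he', IsDualFrame.changeRight, h.ne.symm]
  have hf' : ∀ I : Fin k → Fin n, b < boostWeight o o' I → f (fun r => e' (I r)) = 0 :=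
    fun I hI => changeRight_component h hn f hf q I hI
  refine ⟨e', h', he'o, fun I hI => hI.elim (hf' I) fun hI => ?_⟩
  have hσl : σ l = c • q := by rw [hq, smul_smul, mul_inv_cancel₀ hc0, one_smul]
  have hσq : ∃ d : ℂ, l = d • σ q := by
    refine ⟨star c, ?_⟩
    rw [hq, map_smulₛₗ, hσσ, smul_smul]
    simp [hc0]
  obtain ⟨d, hd⟩ := hσq
  have hd0 : d ≠ 0 := by
    rintro rfl
    rw [hd, zero_smul] at hlq
    simp at hlq
  -- `σ` swaps the lines of `l` and `q`, hence preserves their orthogonal complement. The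
  -- coefficient of `σ (e' i)` along `e' j` is, up to sign, its product with the dual vector of `e'
  -- j`, which has opposite weight; thus `σ` reverses the weight.
  have key : ∀ i m, B (σ (e' i)) (e' m) ≠ 0 → weight o o' m = weight o o' i := by
    intro i m hij
    by_cases hmo : m = o
    · rw [hmo, he'o, hd, map_smul, hσB, smul_eq_mul, ← he'o', h'.pair_right] at hij
      by_cases hio : i = o
      · rw [hmo, hio]
      · simp [hio] at hij
    by_cases hmo' : m = o'
    · rw [hmo', he'o', hq, map_smul, hσB, smul_eq_mul, ← he'o, h'.pair_left] at hij
      by_cases hio : i = o'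
      · rw [hmo', hio]
      · simp [hio] at hij
    by_cases hio : i = o
    · rw [hio, he'o, hσl, ← he'o', hB, map_smul, h'.pair_right] at hij
      simp [hmo] at hij
    by_cases hio' : i = o'
    · have : σ q = d⁻¹ • l := by rw [hd, smul_smul, inv_mul_cancel₀ hd0, one_smul]
      rw [hio', he'o', this, ← he'o, hB, map_smul, h'.pair_left] at hij
      simp [hmo'] at hij
    simp [weight, hmo, hmo', hio, hio']
  have hz : f (fun r => σ (e' (I r))) = 0 := by
    refine map_eq_zero_of_expansion f e' _
      (fun r j => s j * B (σ (e' (I r))) (e' (Equiv.swap o o' j)))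
      (fun r => h'.expansion hn _) fun J hJ => hf' J ?_
    have : boostWeight o o' J = - boostWeight o o' I := by
      rw [boostWeight_eq_sum, boostWeight_eq_sum, ← Finset.sum_neg_distrib]
      refine Finset.sum_congr rfl fun r _ => ?_
      rw [← key _ _ (right_ne_zero_of_mul (hJ r)), weight_swap _ _ _ h.ne, neg_neg]
    rw [this]
    linarith
  rw [hσf] at hz
  exact star_eq_zero.1 hz

end RealStructures

/-! ### The algebraic obstruction to types N, III and II -/

section Types

variable {n k : ℕ}

/-- Passes to a notion of null frame that makes sense over any field, so that the frame can be
complexified and altered by complex null rotations. -/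
theorem isDualFrame_of_isNullFrame {G : Matrix (Fin n) (Fin n) ℝ} (hG : G.IsSymm)
    {e : Fin n → Fin n → ℝ} {o o' : Fin n} (h : IsNullFrame G e o o') :
    ∃ (ε : ℝ), (ε = 1 ∨ ε = -1) ∧ IsDualFrame (Matrix.toLinearMap₂' ℝ G) e o o'
      (fun i => if i = o ∨ i = o' then 1 else ε) := by
  obtain ⟨ε, hε, hort⟩ := h.orthonormal
  have hs : ∀ v w : Fin n → ℝ, v ⬝ᵥ G.mulVec w = w ⬝ᵥ G.mulVec v := fun v w => by
    rw [Matrix.dotProduct_mulVec, ← Matrix.mulVec_transpose, hG.eq, dotProduct_comm]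
  have hne := h.ne
  have hne' := h.ne.symm
  refine ⟨ε, hε, h.ne, fun i j => ?_, by simp, by simp, fun i => ?_⟩
  · rw [Matrix.toLinearMap₂'_apply']
    by_cases hj : j = o
    · subst hj
      rw [Equiv.swap_apply_left]
      by_cases hi : i = j
      · subst hi; simp [h.pairing]
      · by_cases hi' : i = o'
        · subst hi'; simp [h.null_right, hi]
        · rw [hs, (h.transverse i hi hi').2]; simp [hi]
    by_cases hj' : j = o'
    · subst hj'
      rw [Equiv.swap_apply_right]
      by_cases hi : i = o
      · subst hi; simp [h.null_left, hne]
      · by_cases hi' : i = j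
        · subst hi'; rw [hs]; simp [h.pairing]
        · rw [hs, (h.transverse i hi hi').1]; simp [hi']
    rw [Equiv.swap_apply_of_ne_of_ne hj hj']
    by_cases hi : i = o
    · subst hi; simp [(h.transverse j hj hj').1, Ne.symm hj]
    by_cases hi' : i = o'
    · subst hi'; simp [(h.transverse j hj hj').2, Ne.symm hj']
    simp [hort i j hi hi' hj hj', hi, hi']
  · rcases hε with rfl | rfl <;> split_ifs <;> norm_num

theorem isNullFrame_of_isDualFrame {G : Matrix (Fin n) (Fin n) ℝ} (hG : G.IsSymm)
    {e : Fin n → Fin n → ℝ} {o o' : Fin n} {ε : ℝ} (hε : ε = 1 ∨ ε = -1)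
    (h : IsDualFrame (Matrix.toLinearMap₂' ℝ G) e o o' (fun i => if i = o ∨ i = o' then 1 else ε)) :
    IsNullFrame G e o o' := by
  have hs : ∀ v w : Fin n → ℝ, v ⬝ᵥ G.mulVec w = w ⬝ᵥ G.mulVec v := fun v w => by
    rw [Matrix.dotProduct_mulVec, ← Matrix.mulVec_transpose, hG.eq, dotProduct_comm]
  have h1 := h.pair_left
  have h2 := h.pair_right
  have h3 := h.pair_transverse
  simp only [Matrix.toLinearMap₂'_apply'] at h1 h2 h3
  refine ⟨h.ne, by rw [h1, if_neg h.ne], by rw [h2, if_neg h.ne.symm], by rw [h2, if_pos rfl],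
    fun i hi hi' => ⟨by rw [hs, h1, if_neg hi'], by rw [hs, h2, if_neg hi]⟩,
    ε, hε, fun i j hi hi' hj hj' => by rw [h3 i j hj hj']; simp [hi, hi']⟩

theorem toComplex_dotProduct (G : Matrix (Fin n) (Fin n) ℝ) (v w : Fin n → ℝ) :
    Matrix.toLinearMap₂' ℂ (G.map Complex.ofReal) (toComplex v) (toComplex w)
      = ((Matrix.toLinearMap₂' ℝ G v w : ℝ) : ℂ) := by
  simp only [Matrix.toLinearMap₂'_apply', dotProduct, Matrix.mulVec, toComplex, Matrix.map_apply]
  push_cast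
  rfl

theorem tensorMap_toComplex (T : (Fin k → Fin n) → ℝ) (v : Fin k → Fin n → ℝ) :
    tensorMap (fun I => (T I : ℂ)) (fun r => toComplex (v r)) = ((tensorMap T v : ℝ) : ℂ) := by
  simp only [tensorMap_apply, toComplex]
  push_cast
  rfl

theorem tensorMap_star (T : (Fin k → Fin n) → ℝ) (v : Fin k → Fin n → ℂ) :
    tensorMap (fun I => (T I : ℂ)) (fun r => star (v r))
      = star (tensorMap (fun I => (T I : ℂ)) v) := by
  simp only [tensorMap_apply, star_sum, star_mul', star_prod, Pi.star_apply]
  simp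

theorem isDualFrame_toComplex {G : Matrix (Fin n) (Fin n) ℝ} {e : Fin n → Fin n → ℝ} {o o' : Fin n}
    {s : Fin n → ℝ} (h : IsDualFrame (Matrix.toLinearMap₂' ℝ G) e o o' s) :
    IsDualFrame (Matrix.toLinearMap₂' ℂ (G.map Complex.ofReal)) (fun i => toComplex (e i)) o o'
      (fun i => (s i : ℂ)) := by
  refine ⟨h.ne, fun i j => ?_, by simp [h.sign_left], by simp [h.sign_right], fun i => ?_⟩
  · rw [toComplex_dotProduct, h.pair]
    split_ifs <;> simp
  · exact_mod_cast h.sign_sq i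

/-- The infinitesimal boost depends linearly on its second null direction. -/
theorem boostAction_toComplex_re (G : Matrix (Fin n) (Fin n) ℝ) (T : (Fin k → Fin n) → ℝ)
    (l : Fin n → ℝ) (q : Fin n → ℂ) (v : Fin k → Fin n → ℝ) :
    (boostAction (Matrix.toLinearMap₂' ℂ (G.map Complex.ofReal)) (toComplex l) q
      (tensorMap (fun I => (T I : ℂ))) (fun r => toComplex (v r))).re
      = boostAction (Matrix.toLinearMap₂' ℝ G) l (fun i => (q i).re) (tensorMap T) v := by
  set x : Fin n → ℝ := fun i => (q i).re
  set y : Fin n → ℝ := fun i => (q i).im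
  have hq : q = toComplex x + Complex.I • toComplex y := by
    ext i
    simp [toComplex, x, y, mul_comm Complex.I, Complex.re_add_im]
  have hb : ∀ w : Fin n → ℝ, boost (Matrix.toLinearMap₂' ℂ (G.map Complex.ofReal)) (toComplex l) q
      (toComplex w) = toComplex (boost (Matrix.toLinearMap₂' ℝ G) l x w)
        + Complex.I • toComplex (boost (Matrix.toLinearMap₂' ℝ G) l y w) := by
    intro w
    simp only [boost, hq, map_add, map_smul, toComplex_dotProduct]
    ext i
    simp [toComplex]
    ring
  have hu : ∀ (r : Fin k) (w : Fin n → ℝ),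
      Function.update (fun r => toComplex (v r)) r (toComplex w)
        = fun r' => toComplex (Function.update v r w r') := by
    intro r w
    ext r' i
    by_cases hr : r' = r
    · subst hr; simp
    · simp [hr]
  rw [boostAction, boostAction, Complex.re_sum]
  refine Finset.sum_congr rfl fun r _ => ?_
  rw [hb, MultilinearMap.map_update_add, MultilinearMap.map_update_smul, hu, hu,
    tensorMap_toComplex, tensorMap_toComplex]
  simp

/-- A tensor that is real both on a Lorentzian and on a definite real form of a complex quadratic
space is not of proper type N, III or II on the Lorentzian one. -/
theorem not_isProperlySpecial {G H : Matrix (Fin n) (Fin n) ℝ} (hG : G.IsSymm)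
    (hH : H.PosDef ∨ (-H).PosDef) {A : Matrix (Fin n) (Fin n) ℂ} (hA : IsUnit A.det)
    (hGH : A.transpose * G.map Complex.ofReal * A = H.map Complex.ofReal)
    {T S : (Fin k → Fin n) → ℝ}
    (hTS : ∀ I, (S I : ℂ)
      = tensorMap (fun I => (T I : ℂ)) (fun r => A.mulVec (Pi.single (I r) 1))) :
    ¬ IsProperlySpecial G T := by
  set B : (Fin n → ℂ) →ₗ[ℂ] (Fin n → ℂ) →ₗ[ℂ] ℂ :=
    Matrix.toLinearMap₂' ℂ (G.map Complex.ofReal) with hB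
  set f := tensorMap (fun I => (T I : ℂ)) with hf
  have hBsymm : ∀ v w, B v w = B w v := by
    intro v w
    have : (G.map Complex.ofReal).IsSymm := hG.map _
    rw [hB, Matrix.toLinearMap₂'_apply', Matrix.toLinearMap₂'_apply', Matrix.dotProduct_mulVec,
      ← Matrix.mulVec_transpose, this.eq, dotProduct_comm]
  have hRsymm : ∀ v w : Fin n → ℝ, Matrix.toLinearMap₂' ℝ G v w = Matrix.toLinearMap₂' ℝ G w v := by
    intro v w
    rw [Matrix.toLinearMap₂'_apply', Matrix.toLinearMap₂'_apply', Matrix.dotProduct_mulVec,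
      ← Matrix.mulVec_transpose, hG.eq, dotProduct_comm]
  have hAA : ∀ v, A.mulVec (A⁻¹.mulVec v) = v := fun v => by
    rw [Matrix.mulVec_mulVec, Matrix.mul_nonsing_inv _ hA, Matrix.one_mulVec]
  have hAA' : ∀ v, A⁻¹.mulVec (A.mulVec v) = v := fun v => by
    rw [Matrix.mulVec_mulVec, Matrix.nonsing_inv_mul _ hA, Matrix.one_mulVec]
  have hBA : ∀ u w, B (A.mulVec u) (A.mulVec w) = u ⬝ᵥ (H.map Complex.ofReal).mulVec w := by
    intro u w
    rw [hB, Matrix.toLinearMap₂'_apply', ← hGH, Matrix.mul_assoc, ← Matrix.mulVec_mulVec,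
      ← Matrix.mulVec_mulVec, Matrix.dotProduct_mulVec u, Matrix.vecMul_transpose]
  have hfA : ∀ u : Fin k → Fin n → ℂ,
      f (fun r => A.mulVec (u r)) = tensorMap (fun I => (S I : ℂ)) u := fun u =>
    (tensorMap_pullback hTS u).symm
  -- Complex conjugation relative to the real form spanned by the columns of `A`, on which the
  -- quadratic form is definite.
  let σ : (Fin n → ℂ) →ₗ⋆[ℂ] (Fin n → ℂ) :=
    { toFun := fun v => A.mulVec (star (A⁻¹.mulVec v))
      map_add' := fun v w => by simp [Matrix.mulVec_add]
      map_smul' := fun c v => by simp [Matrix.mulVec_smul] }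
  have hσ : ∀ v, σ v = A.mulVec (star (A⁻¹.mulVec v)) := fun v => rfl
  have hσA : ∀ u, σ (A.mulVec u) = A.mulVec (star u) := fun u => by rw [hσ, hAA']
  have hσσ : ∀ v, σ (σ v) = v := fun v => by rw [hσ v, hσA, star_star, hAA]
  have hσB : ∀ v w, B (σ v) (σ w) = star (B v w) := by
    intro v w
    rw [← hAA v, ← hAA w, hσA, hσA, hBA, hBA]
    simp only [dotProduct, Matrix.mulVec, Matrix.map_apply, star_sum, star_mul', Pi.star_apply]
    simp
  have hσf : ∀ v : Fin k → Fin n → ℂ, f (fun r => σ (v r)) = star (f v) := by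
    intro v
    have hv : v = fun r => A.mulVec (A⁻¹.mulVec (v r)) := by simp only [hAA]
    rw [hv]
    simp only [hσA]
    rw [hfA, hfA, tensorMap_star]
  have haniso : ∀ v, B v (σ v) = 0 → v = 0 := by
    intro v hv
    suffices h : A⁻¹.mulVec v = 0 by rw [← hAA v, h, Matrix.mulVec_zero]
    set u := A⁻¹.mulVec v
    rw [hσ, ← hAA v, hBA, hAA] at hv
    -- With u = x + iy, the real part of the hermitian form at u is the sum of the values of `P` at
    -- x and at y, both nonnegative.
    have hre : ∀ P : Matrix (Fin n) (Fin n) ℝ, P.PosDef →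
        u ⬝ᵥ (P.map Complex.ofReal).mulVec (star u) = 0 → u = 0 := by
      intro P hP h0
      have hre := congrArg Complex.re h0
      have : (u ⬝ᵥ (P.map Complex.ofReal).mulVec (star u)).re
          = (fun i => (u i).re) ⬝ᵥ P.mulVec (fun i => (u i).re)
            + (fun i => (u i).im) ⬝ᵥ P.mulVec (fun i => (u i).im) := by
        simp [dotProduct, Matrix.mulVec, ← Finset.sum_add_distrib, Finset.mul_sum]
      rw [this] at hre
      have hnn : ∀ x : Fin n → ℝ, 0 ≤ x ⬝ᵥ P.mulVec x := fun x => by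
        simpa using hP.posSemidef.dotProduct_mulVec_nonneg x
      have hz : ∀ x : Fin n → ℝ, x ⬝ᵥ P.mulVec x = 0 → x = 0 := fun x hx => by
        by_contra hx0
        have := hP.dotProduct_mulVec_pos hx0
        simp [hx] at this
      have h1 := hnn (fun i => (u i).re)
      have h2 := hnn (fun i => (u i).im)
      simp only [Complex.zero_re] at hre
      have h3 := hz _ (by linarith : (fun i => (u i).re) ⬝ᵥ P.mulVec (fun i => (u i).re) = 0)
      have h4 := hz _ (by linarith : (fun i => (u i).im) ⬝ᵥ P.mulVec (fun i => (u i).im) = 0)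
      ext i
      exact Complex.ext (congrFun h3 i) (congrFun h4 i)
    rcases hH with hH | hH
    · exact hre H hH hv
    · refine hre _ hH ?_
      have : (-H).map Complex.ofReal = -(H.map Complex.ofReal) := by ext; simp
      rw [this, Matrix.neg_mulVec, dotProduct_neg, hv, neg_zero]
  have hn : Module.finrank ℂ (Fin n → ℂ) = n := by simp
  -- the complex null frame
  have main : ∀ b e o o', IsNullFrame G e o o' →
      (∀ I, b < boostWeight o o' I → frameComponent T e I = 0) →
      ∃ e' : Fin n → Fin n → ℂ, ∃ ε : ℝ, (ε = 1 ∨ ε = -1) ∧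
        IsDualFrame (Matrix.toLinearMap₂' ℝ G) e o o'
          (fun i => if i = o ∨ i = o' then 1 else ε) ∧
        IsDualFrame B e' o o' (fun i => ((if i = o ∨ i = o' then 1 else ε : ℝ) : ℂ)) ∧
        e' o = toComplex (e o) ∧
        ∀ I : Fin k → Fin n, (b < boostWeight o o' I ∨ boostWeight o o' I < -b) →
          f (fun r => e' (I r)) = 0 := by
    intro b e o o' hframe hT
    obtain ⟨ε, hε, hd⟩ := isDualFrame_of_isNullFrame hG hframe
    obtain ⟨e', h1, h2, h3⟩ := exists_symmetric_frame (isDualFrame_toComplex hd) hn hBsymm f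
      (b := b) (fun I hI => by
        rw [hf, tensorMap_toComplex, ← frameComponent_eq_tensorMap, hT I hI, Complex.ofReal_zero])
      σ hσσ hσB hσf haniso
    exact ⟨e', ε, hε, hd, h1, h2, h3⟩
  -- negative boost order is impossible for a nonzero tensor
  have hneg : ∀ b : ℤ, b ≤ -1 → BoostOrderLE G T b → T = 0 := by
    rintro b hb ⟨e, o, o', hframe, hT⟩
    obtain ⟨e', ε, -, -, hd, -, hz⟩ := main b e o o' hframe hT
    ext I
    have : f (fun r => Pi.single (I r) 1) = 0 :=
      -- As `b` is negative, every integer is above `b` or below `-b`, so no weight escapes.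
      map_eq_zero_of_expansion f e' _ _ (fun r => hd.expansion hn _) fun J _ => hz J (by omega)
    rw [hf, tensorMap_single] at this
    exact_mod_cast this
  -- For the bound 0 the symmetric frame leaves weight zero alone. Its second null vector is
  -- complex, and must be replaced by a real one without losing boost invariance.
  have hzero : BoostOrderLE G T 0 → OnlyBoostWeightZero G T := by
    rintro ⟨e, o, o', hframe, hT⟩
    obtain ⟨e', ε, hε, hdR, hd, he', hz⟩ := main 0 e o o' hframe hT
    have hact := boostAction_eq_zero hd hn f (fun I hI => hz I (by omega))
    rw [he'] at hact
    set x : Fin n → ℝ := fun i => (e' o' i).re with hx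
    have hxact : ∀ v, boostAction (Matrix.toLinearMap₂' ℝ G) (e o) x (tensorMap T) v = 0 := by
      intro v
      rw [hx, ← boostAction_toComplex_re, ← hB, ← hf, hact, Complex.zero_re]
    set BR : (Fin n → ℝ) →ₗ[ℝ] (Fin n → ℝ) →ₗ[ℝ] ℝ := Matrix.toLinearMap₂' ℝ G with hBR
    have hlx : BR (e o) x = 1 := by
      have h1 : B (toComplex (e o)) (e' o') = 1 := by rw [← he', hd.pair_right, if_pos rfl]
      have h2 := congrArg Complex.re h1
      rw [hB, Matrix.toLinearMap₂'_apply'] at h2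
      rw [hBR, Matrix.toLinearMap₂'_apply']
      simpa [dotProduct, Matrix.mulVec, toComplex, hx] using h2
    have hll : BR (e o) (e o) = 0 := by rw [hdR.pair_left, if_neg hdR.ne]
    -- The multiple of the null vector `e o` that makes `x` null, given that their product is 1. The
    -- boost is unaffected, because it is alternating in its two directions.
    set q := x - (BR x x / 2) • e o with hq
    have hlq : BR (e o) q = 1 := by rw [hq, map_sub, map_smul, hlx, hll]; simp
    have hqq : BR q q = 0 := by
      rw [hq]
      simp only [map_sub, map_smul, LinearMap.sub_apply, LinearMap.smul_apply, hlx, hll,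
        hRsymm x (e o), smul_eq_mul]
      ring
    have hqact : ∀ v, boostAction BR (e o) q (tensorMap T) v = 0 := by
      intro v
      rw [← hxact v]
      refine Finset.sum_congr rfl fun r _ => ?_
      congr 2
      simp only [boost, hq, map_sub, map_smul, sub_smul, smul_sub, smul_smul, smul_eq_mul]
      rw [mul_comm]
      abel
    have hd' := hdR.changeRight_isDualFrame hRsymm hqq hlq
    refine ⟨_, o, o', isNullFrame_of_isDualFrame hG hε hd', fun I hI => ?_⟩
    have := boostAction_frame hd' (tensorMap T) I
    have h1 : IsDualFrame.changeRight BR e o o' q o = e o := by simp [IsDualFrame.changeRight]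
    have h2 : IsDualFrame.changeRight BR e o o' q o' = q := by
      simp [IsDualFrame.changeRight, hdR.ne.symm]
    rw [h1, h2, hqact] at this
    rw [frameComponent_eq_tensorMap]
    have hI' : (boostWeight o o' I : ℝ) ≠ 0 := by exact_mod_cast hI
    exact (mul_eq_zero.1 this.symm).resolve_left hI'
  rintro (⟨hT, hN⟩ | ⟨hIII, hIII'⟩ | ⟨hII, hII', hII''⟩)
  · exact hT (hneg _ (by norm_num) hN)
  · obtain rfl := hneg _ le_rfl hIII
    obtain ⟨e, o, o', hframe, -⟩ := hIII
    exact hIII' ⟨e, o, o', hframe, fun I _ => by simp [frameComponent]⟩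
  · exact hII'' ⟨hII, hII', hzero hII⟩

end Types

/-! ### Calculus along a real analytic map into complex space -/

section Calculus

variable {n : ℕ}

/-- The derivative of `u` in the direction of the `i`-th coordinate of `ℝⁿ`. -/
def coordDeriv {E : Type*} [NormedAddCommGroup E] [NormedSpace ℝ E] (i : Fin n)
    (u : (Fin n → ℝ) → E) (y : Fin n → ℝ) : E :=
  fderiv ℝ u y (Pi.single i 1)

section

variable {E : Type*} [NormedAddCommGroup E] [NormedSpace ℝ E]

theorem coordDeriv_add {i : Fin n} {u v : (Fin n → ℝ) → E} {y : Fin n → ℝ}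
    (hu : DifferentiableAt ℝ u y) (hv : DifferentiableAt ℝ v y) :
    coordDeriv i (fun y => u y + v y) y = coordDeriv i u y + coordDeriv i v y := by
  rw [coordDeriv, fderiv_fun_add hu hv]
  rfl

theorem coordDeriv_sum_smul [NormedSpace ℂ E] {i : Fin n} {ι : Type*} (s : Finset ι)
    {c : ι → (Fin n → ℝ) → ℂ} {u : ι → (Fin n → ℝ) → E} {y : Fin n → ℝ}
    (hc : ∀ k ∈ s, DifferentiableAt ℝ (c k) y) (hu : ∀ k ∈ s, DifferentiableAt ℝ (u k) y) :
    coordDeriv i (fun y => ∑ k ∈ s, c k y • u k y) y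
      = ∑ k ∈ s, (coordDeriv i (c k) y • u k y + c k y • coordDeriv i (u k) y) := by
  have := HasFDerivAt.fun_sum fun k hk => (hc k hk).hasFDerivAt.fun_smul (hu k hk).hasFDerivAt
  rw [coordDeriv, this.fderiv, sum_apply]
  refine Finset.sum_congr rfl fun k _ => ?_
  simp [coordDeriv, add_comm]

theorem analyticAt_coordDeriv [CompleteSpace E] {u : (Fin n → ℝ) → E} {y : Fin n → ℝ}
    (hu : AnalyticAt ℝ u y) (i : Fin n) : AnalyticAt ℝ (coordDeriv i u) y :=
  ((ContinuousLinearMap.apply ℝ E (Pi.single i 1 : Fin n → ℝ)).analyticAt _).comp hu.fderiv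

theorem coordDeriv_comm [CompleteSpace E] {u : (Fin n → ℝ) → E} {y : Fin n → ℝ}
    (hu : AnalyticAt ℝ u y) (i j : Fin n) :
    coordDeriv i (coordDeriv j u) y = coordDeriv j (coordDeriv i u) y := by
  have hs : IsSymmSndFDerivAt ℝ u y :=
    (hu.contDiffAt (n := ω)).isSymmSndFDerivAt_of_omega
  have h : ∀ i j, coordDeriv i (coordDeriv j u) y
      = fderiv ℝ (fderiv ℝ u) y (Pi.single i 1) (Pi.single j 1) := by
    intro i j
    have := ((ContinuousLinearMap.apply ℝ E (Pi.single j 1 : Fin n → ℝ)).hasFDerivAt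
      (x := fderiv ℝ u y)).comp y hu.fderiv.differentiableAt.hasFDerivAt
    have h2 : coordDeriv j u
      = (ContinuousLinearMap.apply ℝ E (Pi.single j 1 : Fin n → ℝ)) ∘ fderiv ℝ u := rfl
    rw [h2, coordDeriv, this.fderiv]
    rfl
  rw [h, h]
  exact hs _ _

theorem coordDeriv_congr {u v : (Fin n → ℝ) → E} {y : Fin n → ℝ} (h : u =ᶠ[nhds y] v)
    (i : Fin n) : coordDeriv i u y = coordDeriv i v y := by
  rw [coordDeriv, h.fderiv_eq]
  rfl

end

theorem ofReal_pderiv {f : (Fin n → ℝ) → ℝ} {y : Fin n → ℝ} (hf : DifferentiableAt ℝ f y)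
    (i : Fin n) : ((pderiv i f y : ℝ) : ℂ) = coordDeriv i (fun y => (f y : ℂ)) y := by
  have := (Complex.ofRealCLM.hasFDerivAt (x := f y)).comp y hf.hasFDerivAt
  have h2 : (fun y => (f y : ℂ)) = Complex.ofRealCLM ∘ f := rfl
  rw [h2, coordDeriv, this.fderiv]
  rfl

theorem fderiv_eq_sum_pderiv {𝕜 : Type*} [RCLike 𝕜] (F : (Fin n → 𝕜) → 𝕜) (z X : Fin n → 𝕜) :
    fderiv 𝕜 F z X = ∑ d, X d * pderiv d F z := by
  conv_lhs => rw [pi_eq_sum_univ' X]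
  simp [map_sum, pderiv]

/-- The derivative of a matrix of functions in the direction of the vector `X`. -/
def dirDeriv {𝕜 : Type*} [RCLike 𝕜] (M : (Fin n → 𝕜) → Matrix (Fin n) (Fin n) 𝕜)
    (z X : Fin n → 𝕜) : Matrix (Fin n) (Fin n) 𝕜 :=
  fun a b => ∑ d, X d * pderiv d (fun z => M z a b) z

/-- The product rule. Because `M` is complex differentiable, its contribution is a complex
directional derivative along the complex vector `coordDeriv i ι y`, and so is expressed by the
holomorphic partial derivatives of `M`. -/
theorem coordDeriv_bilin {M : (Fin n → ℂ) → Matrix (Fin n) (Fin n) ℂ}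
    {ι u v : (Fin n → ℝ) → Fin n → ℂ} {y : Fin n → ℝ} (hι : DifferentiableAt ℝ ι y)
    (hM : ∀ a b, DifferentiableAt ℂ (fun z => M z a b) (ι y))
    (hu : DifferentiableAt ℝ u y) (hv : DifferentiableAt ℝ v y) (i : Fin n) :
    coordDeriv i (fun y => Matrix.toLinearMap₂' ℂ (M (ι y)) (u y) (v y)) y
      = Matrix.toLinearMap₂' ℂ (dirDeriv M (ι y) (coordDeriv i ι y)) (u y) (v y)
        + Matrix.toLinearMap₂' ℂ (M (ι y)) (coordDeriv i u y) (v y)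
        + Matrix.toLinearMap₂' ℂ (M (ι y)) (u y) (coordDeriv i v y) := by
  have h1 : ∀ a, HasFDerivAt (fun y => u y a)
      ((ContinuousLinearMap.proj (R := ℝ) a).comp (fderiv ℝ u y)) y :=
    hasFDerivAt_pi'.1 hu.hasFDerivAt
  have h2 : ∀ a, HasFDerivAt (fun y => v y a)
      ((ContinuousLinearMap.proj (R := ℝ) a).comp (fderiv ℝ v y)) y :=
    hasFDerivAt_pi'.1 hv.hasFDerivAt
  have h3 : ∀ a b, HasFDerivAt (fun y => M (ι y) a b)
      (((fderiv ℂ (fun z => M z a b) (ι y)).restrictScalars ℝ).comp (fderiv ℝ ι y)) y :=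
    fun a b => ((hM a b).hasFDerivAt.restrictScalars ℝ).comp y hι.hasFDerivAt
  have h4 := HasFDerivAt.fun_sum (u := Finset.univ) fun a _ =>
    HasFDerivAt.fun_sum (u := Finset.univ) fun b _ => (h1 a).fun_mul ((h2 b).fun_mul (h3 a b))
  simp only [Matrix.toLinearMap₂'_apply, smul_eq_mul]
  rw [coordDeriv, h4.fderiv]
  simp only [sum_apply, ← Finset.sum_add_distrib]
  refine Finset.sum_congr rfl fun a _ => Finset.sum_congr rfl fun b _ => ?_
  simp [fderiv_eq_sum_pderiv, dirDeriv, coordDeriv]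
  ring

end Calculus

/-! ### Christoffel symbols and curvature in coordinate-free form -/

section Analyticity

variable {𝕜 : Type*} [RCLike 𝕜] {n : ℕ} {g : (Fin n → 𝕜) → Matrix (Fin n) (Fin n) 𝕜}
  {x : Fin n → 𝕜}

theorem analyticAt_pderiv {f : (Fin n → 𝕜) → 𝕜} (hf : AnalyticAt 𝕜 f x) (i : Fin n) :
    AnalyticAt 𝕜 (pderiv i f) x :=
  ((ContinuousLinearMap.apply 𝕜 𝕜 (Pi.single i 1 : Fin n → 𝕜)).analyticAt _).comp hf.fderiv

theorem analyticAt_det {E : Type*} [NormedAddCommGroup E] [NormedSpace 𝕜 E]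
    {g : E → Matrix (Fin n) (Fin n) 𝕜} {x : E} (hg : ∀ i j, AnalyticAt 𝕜 (fun y => g y i j) x) :
    AnalyticAt 𝕜 (fun y => (g y).det) x := by
  simp only [Matrix.det_apply]
  refine Finset.analyticAt_fun_sum _ fun σ _ => ?_
  exact (Finset.analyticAt_fun_prod _ fun i _ => hg _ _).const_smul

theorem analyticAt_inv_apply (hg : ∀ i j, AnalyticAt 𝕜 (fun y => g y i j) x)
    (hx : (g x).det ≠ 0) (i j : Fin n) : AnalyticAt 𝕜 (fun y => (g y)⁻¹ i j) x := by
  simp only [Matrix.inv_def, Ring.inverse_eq_inv', Matrix.smul_apply, smul_eq_mul,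
    Matrix.adjugate_apply]
  refine ((analyticAt_det hg).inv hx).mul (analyticAt_det fun a b => ?_)
  by_cases ha : a = j
  · subst ha
    simpa using analyticAt_const
  · simpa [Matrix.updateRow_ne ha] using hg a b

theorem analyticAt_christoffel (hg : ∀ i j, AnalyticAt 𝕜 (fun y => g y i j) x)
    (hx : (g x).det ≠ 0) (k i j : Fin n) : AnalyticAt 𝕜 (christoffel g k i j) x := by
  unfold christoffel
  refine analyticAt_const.mul (Finset.analyticAt_fun_sum _ fun l _ => ?_)
  exact (analyticAt_inv_apply hg hx k l).mul
    (((analyticAt_pderiv (hg _ _) _).add (analyticAt_pderiv (hg _ _) _)).sub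
      (analyticAt_pderiv (hg _ _) _))

/-- Lowering the upper index gives the Christoffel symbols of the first kind. -/
theorem lower_christoffel (hx : (g x).det ≠ 0) (m i j : Fin n) :
    ∑ k, g x m k * christoffel g k i j x
      = 2⁻¹ * (pderiv i (fun y => g y j m) x + pderiv j (fun y => g y i m) x
          - pderiv m (fun y => g y i j) x) := by
  set D : Fin n → 𝕜 := fun l =>
    pderiv i (fun y => g y j l) x + pderiv j (fun y => g y i l) x - pderiv l (fun y => g y i j) x
  have h : (fun k => christoffel g k i j x) = (2⁻¹ : 𝕜) • ((g x)⁻¹).mulVec D := by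
    ext k; rfl
  have h2 : ∑ k, g x m k * christoffel g k i j x
      = (g x).mulVec (fun k => christoffel g k i j x) m := rfl
  rw [h2, h, Matrix.mulVec_smul, Matrix.mulVec_mulVec,
    Matrix.mul_nonsing_inv _ (isUnit_iff_ne_zero.2 hx), Matrix.one_mulVec]
  rfl

theorem sum_reverse {ι R : Type*} [Fintype ι] [AddCommMonoid R] (f : ι → ι → ι → R) :
    ∑ a, ∑ b, ∑ c, f a b c = ∑ c, ∑ b, ∑ a, f a b c := by
  calc ∑ a, ∑ b, ∑ c, f a b c = ∑ a, ∑ c, ∑ b, f a b c :=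
        Finset.sum_congr rfl fun a _ => Finset.sum_comm
    _ = ∑ c, ∑ a, ∑ b, f a b c := Finset.sum_comm
    _ = ∑ c, ∑ b, ∑ a, f a b c := Finset.sum_congr rfl fun c _ => Finset.sum_comm

/-- The vector `Γ(X, Y)`. -/
def connection (g : (Fin n → 𝕜) → Matrix (Fin n) (Fin n) 𝕜) (x X Y : Fin n → 𝕜) : Fin n → 𝕜 :=
  fun a => Matrix.toLinearMap₂' 𝕜 (Matrix.of fun p q => christoffel g a p q x) X Y

/-- The Koszul formula for constant vector fields; it removes the inverse metric from later
computations. -/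
theorem inner_connection (hx : (g x).det ≠ 0) (X Y Z : Fin n → 𝕜) :
    Matrix.toLinearMap₂' 𝕜 (g x) Z (connection g x X Y)
      = 2⁻¹ * (Matrix.toLinearMap₂' 𝕜 (dirDeriv g x X) Y Z
          + Matrix.toLinearMap₂' 𝕜 (dirDeriv g x Y) X Z
          - Matrix.toLinearMap₂' 𝕜 (dirDeriv g x Z) X Y) := by
  have h1 : Matrix.toLinearMap₂' 𝕜 (g x) Z (connection g x X Y)
      = ∑ z, ∑ p, ∑ q, Z z * X p * Y q * ∑ k, g x z k * christoffel g k p q x := by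
    simp only [connection, Matrix.toLinearMap₂'_apply, smul_eq_mul, Finset.mul_sum,
      Finset.sum_mul, Matrix.of_apply]
    refine Finset.sum_congr rfl fun z _ => ?_
    rw [Finset.sum_comm]
    refine Finset.sum_congr rfl fun p _ => ?_
    rw [Finset.sum_comm]
    refine Finset.sum_congr rfl fun q _ => Finset.sum_congr rfl fun k _ => ?_
    ring
  have h2 : Matrix.toLinearMap₂' 𝕜 (dirDeriv g x X) Y Z
      = ∑ z, ∑ p, ∑ q, Z z * X p * Y q * pderiv p (fun y => g y q z) x := by
    simp only [Matrix.toLinearMap₂'_apply, smul_eq_mul, dirDeriv, Finset.mul_sum]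
    rw [Finset.sum_comm]
    refine Finset.sum_congr rfl fun z _ => ?_
    rw [Finset.sum_comm]
    refine Finset.sum_congr rfl fun p _ => Finset.sum_congr rfl fun k _ => ?_
    ring
  have h3 : Matrix.toLinearMap₂' 𝕜 (dirDeriv g x Y) X Z
      = ∑ z, ∑ p, ∑ q, Z z * X p * Y q * pderiv q (fun y => g y p z) x := by
    simp only [Matrix.toLinearMap₂'_apply, smul_eq_mul, dirDeriv, Finset.mul_sum]
    rw [Finset.sum_comm]
    refine Finset.sum_congr rfl fun z _ => ?_
    refine Finset.sum_congr rfl fun p _ => Finset.sum_congr rfl fun k _ => ?_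
    ring
  have h4 : Matrix.toLinearMap₂' 𝕜 (dirDeriv g x Z) X Y
      = ∑ z, ∑ p, ∑ q, Z z * X p * Y q * pderiv z (fun y => g y p q) x := by
    simp only [Matrix.toLinearMap₂'_apply, smul_eq_mul, dirDeriv, Finset.mul_sum]
    rw [Finset.sum_comm (s := (Finset.univ : Finset (Fin n))) (t := Finset.univ)
      (f := fun z p => ∑ q, Z z * X p * Y q * pderiv z (fun y => g y p q) x)]
    refine Finset.sum_congr rfl fun p _ => ?_
    rw [Finset.sum_comm]
    refine Finset.sum_congr rfl fun z _ => Finset.sum_congr rfl fun k _ => ?_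
    ring
  rw [h1, h2, h3, h4]
  simp only [← Finset.sum_add_distrib, ← Finset.sum_sub_distrib, Finset.mul_sum
    (s := (Finset.univ : Finset (Fin n))) (a := (2⁻¹ : 𝕜)), lower_christoffel hx]
  refine Finset.sum_congr rfl fun z _ => Finset.sum_congr rfl fun p _ =>
    Finset.sum_congr rfl fun q _ => ?_
  ring

/-- The vector `R(X; Y, Z)` with components `R^a_{bcd} X^b Y^c Z^d`. -/
def curvature (g : (Fin n → 𝕜) → Matrix (Fin n) (Fin n) 𝕜) (x X Y Z : Fin n → 𝕜) : Fin n → 𝕜 :=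
  fun a => ∑ b, ∑ c, ∑ d, X b * Y c * Z d * riemannUp g x a b c d

/-- The vector `(∂_Y Γ)(Z, X)`. -/
def connectionDeriv (g : (Fin n → 𝕜) → Matrix (Fin n) (Fin n) 𝕜) (x Y Z X : Fin n → 𝕜) :
    Fin n → 𝕜 :=
  fun a => Matrix.toLinearMap₂' 𝕜
    (dirDeriv (fun x => Matrix.of fun p q => christoffel g a p q x) x Y) Z X

theorem curvature_eq (g : (Fin n → 𝕜) → Matrix (Fin n) (Fin n) 𝕜) (x X Y Z : Fin n → 𝕜) :
    curvature g x X Y Z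
      = connectionDeriv g x Y Z X - connectionDeriv g x Z Y X
        + (connection g x Y (connection g x Z X) - connection g x Z (connection g x Y X)) := by
  have h1 : ∀ Y Z a, connectionDeriv g x Y Z X a
      = ∑ b, ∑ c, ∑ d, X b * Y c * Z d * pderiv c (christoffel g a d b) x := by
    intro Y Z a
    simp only [connectionDeriv, Matrix.toLinearMap₂'_apply, smul_eq_mul, dirDeriv, Finset.mul_sum,
      Matrix.of_apply]
    rw [Finset.sum_comm]
    refine Finset.sum_congr rfl fun b _ => ?_
    rw [Finset.sum_comm]
    refine Finset.sum_congr rfl fun c _ => Finset.sum_congr rfl fun d _ => ?_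
    ring
  have h2 : ∀ Y Z a, connection g x Y (connection g x Z X) a
      = ∑ b, ∑ c, ∑ d, X b * Y c * Z d
          * ∑ e, christoffel g a c e x * christoffel g e d b x := by
    intro Y Z a
    simp only [connection, Matrix.toLinearMap₂'_apply, smul_eq_mul, Finset.mul_sum,
      Finset.sum_mul, Matrix.of_apply]
    rw [Finset.sum_comm (s := (Finset.univ : Finset (Fin n))) (t := Finset.univ)
      (f := fun b c => ∑ d, ∑ e, X b * Y c * Z d
        * (christoffel g a c e x * christoffel g e d b x))]
    refine Finset.sum_congr rfl fun c _ => ?_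
    rw [sum_reverse (fun b d e => X b * Y c * Z d
        * (christoffel g a c e x * christoffel g e d b x))]
    refine Finset.sum_congr rfl fun e _ => Finset.sum_congr rfl fun d _ =>
      Finset.sum_congr rfl fun b _ => ?_
    ring
  have h3 : ∀ (Y Z : Fin n → 𝕜) (F : Fin n → Fin n → Fin n → 𝕜),
      ∑ b, ∑ c, ∑ d, X b * Y c * Z d * F b c d = ∑ b, ∑ d, ∑ c, X b * Z d * Y c * F b c d := by
    intro Y Z F
    refine Finset.sum_congr rfl fun b _ => ?_
    rw [Finset.sum_comm]
    refine Finset.sum_congr rfl fun c _ => Finset.sum_congr rfl fun d _ => ?_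
    ring
  ext a
  simp only [Pi.add_apply, Pi.sub_apply]
  rw [h1, h1, h2, h2, h3 Z Y, h3 Z Y]
  simp only [← Finset.sum_add_distrib, ← Finset.sum_sub_distrib, curvature]
  refine Finset.sum_congr rfl fun b _ => Finset.sum_congr rfl fun c _ =>
    Finset.sum_congr rfl fun d _ => ?_
  rw [riemannUp, Finset.sum_sub_distrib]
  ring

end Analyticity

/-! ### Transformation laws of the connection and the curvature on a slice -/

section Slice

variable {n : ℕ}

/-- On the open set `N` the real metric `h` is nondegenerate and is the pullback by the real
analytic map `ι` of the holomorphic metric `G`. -/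
structure IsPullbackMetric (N : Set (Fin n → ℝ)) (ι : (Fin n → ℝ) → Fin n → ℂ)
    (G : (Fin n → ℂ) → Matrix (Fin n) (Fin n) ℂ) (h : (Fin n → ℝ) → Matrix (Fin n) (Fin n) ℝ) :
    Prop where
  isOpen : IsOpen N
  analytic : ∀ y ∈ N, AnalyticAt ℝ ι y
  holomorphic : ∀ y ∈ N, ∀ a b, AnalyticAt ℂ (fun z => G z a b) (ι y)
  symm : ∀ y ∈ N, (h y).IsSymm
  det_ne_zero : ∀ y ∈ N, (h y).det ≠ 0
  eq_pullback : ∀ y ∈ N, ∀ i j, (h y i j : ℂ) = pullback G ι y i j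

/-- The Jacobian matrix. -/
def jacobian (ι : (Fin n → ℝ) → Fin n → ℂ) (y : Fin n → ℝ) : Matrix (Fin n) (Fin n) ℂ :=
  fun a i => coordDeriv i ι y a

theorem jacobian_mulVec (ι : (Fin n → ℝ) → Fin n → ℂ) (y : Fin n → ℝ) (c : Fin n → ℂ) :
    (jacobian ι y).mulVec c = ∑ k, c k • coordDeriv k ι y := by
  ext a
  simp [Matrix.mulVec, dotProduct, jacobian, mul_comm]

theorem jacobian_mulVec_single (ι : (Fin n → ℝ) → Fin n → ℂ) (y : Fin n → ℝ) (i : Fin n) :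
    (jacobian ι y).mulVec (Pi.single i 1) = coordDeriv i ι y := by
  rw [jacobian_mulVec]
  simp [Pi.single_apply]

namespace IsPullbackMetric

variable {N : Set (Fin n → ℝ)} {ι : (Fin n → ℝ) → Fin n → ℂ}
  {G : (Fin n → ℂ) → Matrix (Fin n) (Fin n) ℂ} {h : (Fin n → ℝ) → Matrix (Fin n) (Fin n) ℝ}
  {y : Fin n → ℝ}

theorem eq_bilin (H : IsPullbackMetric N ι G h) (hy : y ∈ N) (i j : Fin n) :
    (h y i j : ℂ) = Matrix.toLinearMap₂' ℂ (G (ι y)) (coordDeriv i ι y) (coordDeriv j ι y) := by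
  rw [H.eq_pullback y hy, pullback, Matrix.toLinearMap₂'_apply]
  simp only [smul_eq_mul, coordDeriv, mul_assoc]

theorem eq_mul (H : IsPullbackMetric N ι G h) (hy : y ∈ N) :
    (h y).map Complex.ofReal = (jacobian ι y).transpose * G (ι y) * jacobian ι y := by
  ext i j
  rw [Matrix.map_apply, H.eq_bilin hy, Matrix.toLinearMap₂'_apply, Matrix.mul_apply]
  simp only [Matrix.mul_apply, Matrix.transpose_apply, jacobian, smul_eq_mul, Finset.sum_mul]
  rw [Finset.sum_comm]
  refine Finset.sum_congr rfl fun b _ => Finset.sum_congr rfl fun a _ => ?_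
  ring

/-- Determinants are multiplicative in h = JᵀGJ. Invertibility of J over `ℂ` says that the tangent
space of the slice is a real form of the complex tangent space. -/
theorem isUnit (H : IsPullbackMetric N ι G h) (hy : y ∈ N) :
    IsUnit (G (ι y)).det ∧ IsUnit (jacobian ι y).det := by
  have h1 : ((h y).map Complex.ofReal).det ≠ 0 := by
    have := RingHom.map_det Complex.ofRealHom (h y)
    have h2 : (h y).map Complex.ofReal = Complex.ofRealHom.mapMatrix (h y) := rfl
    rw [h2, ← this]
    simpa using H.det_ne_zero y hy
  rw [H.eq_mul hy, Matrix.det_mul, Matrix.det_mul] at h1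
  exact ⟨(right_ne_zero_of_mul (left_ne_zero_of_mul h1)).isUnit,
    (right_ne_zero_of_mul h1).isUnit⟩

/-- Symmetry of the holomorphic metric is inherited from the slice: the invertible Jacobian cancels
from JᵀGᵀJ = JᵀGJ. -/
theorem isSymm (H : IsPullbackMetric N ι G h) (hy : y ∈ N) : (G (ι y)).IsSymm := by
  have hJ := (H.isUnit hy).2
  have h1 : ((h y).map Complex.ofReal).transpose = (h y).map Complex.ofReal :=
    (H.symm y hy).map _
  rw [H.eq_mul hy, Matrix.transpose_mul, Matrix.transpose_mul, Matrix.transpose_transpose,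
    ← Matrix.mul_assoc] at h1
  have hJ' : IsUnit (jacobian ι y) := (Matrix.isUnit_iff_isUnit_det _).2 hJ
  have hJt : IsUnit (jacobian ι y).transpose :=
    (Matrix.isUnit_iff_isUnit_det _).2 (by rwa [Matrix.det_transpose])
  exact hJt.mul_left_cancel (hJ'.mul_right_cancel h1)

theorem bilin_comm (H : IsPullbackMetric N ι G h) (hy : y ∈ N) (X Y : Fin n → ℂ) :
    Matrix.toLinearMap₂' ℂ (G (ι y)) X Y = Matrix.toLinearMap₂' ℂ (G (ι y)) Y X := by
  rw [Matrix.toLinearMap₂'_apply', Matrix.toLinearMap₂'_apply', Matrix.dotProduct_mulVec,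
    ← Matrix.mulVec_transpose, (H.isSymm hy).eq, dotProduct_comm]

theorem ext_inner (H : IsPullbackMetric N ι G h) (hy : y ∈ N) {X Y : Fin n → ℂ}
    (hXY : ∀ m, Matrix.toLinearMap₂' ℂ (G (ι y)) (coordDeriv m ι y) X
      = Matrix.toLinearMap₂' ℂ (G (ι y)) (coordDeriv m ι y) Y) : X = Y := by
  have hu : IsUnit ((jacobian ι y).transpose * G (ι y)) := by
    rw [Matrix.isUnit_iff_isUnit_det, Matrix.det_mul, Matrix.det_transpose]
    exact (H.isUnit hy).2.mul (H.isUnit hy).1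
  refine Matrix.mulVec_injective_of_isUnit hu ?_
  ext m
  have := hXY m
  rw [Matrix.toLinearMap₂'_apply', Matrix.toLinearMap₂'_apply'] at this
  simp only [← Matrix.mulVec_mulVec]
  exact this

theorem analyticAt_metric (H : IsPullbackMetric N ι G h) (hy : y ∈ N) (i j : Fin n) :
    AnalyticAt ℝ (fun y => h y i j) y := by
  have hc : AnalyticAt ℝ (fun y => pullback G ι y i j) y := by
    unfold pullback
    refine Finset.analyticAt_fun_sum _ fun a _ => Finset.analyticAt_fun_sum _ fun b _ => ?_
    have hd : ∀ i a, AnalyticAt ℝ (fun y => fderiv ℝ ι y (Pi.single i 1) a) y := fun i a =>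
      analyticAt_pi_iff.1 (analyticAt_coordDeriv (H.analytic y hy) i) a
    exact ((hd i a).mul (hd j b)).mul
      ((H.holomorphic y hy a b).restrictScalars.comp (H.analytic y hy))
  refine ((Complex.reCLM.analyticAt _).comp hc).congr ?_
  filter_upwards [H.isOpen.mem_nhds hy] with w hw
  simp [← H.eq_pullback w hw]

theorem analyticAt_ofReal_christoffel (H : IsPullbackMetric N ι G h) (hy : y ∈ N)
    (k i j : Fin n) : AnalyticAt ℝ (fun y => ((christoffel h k i j y : ℝ) : ℂ)) y :=
  (Complex.ofRealCLM.analyticAt _).comp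
    (analyticAt_christoffel (H.analyticAt_metric hy) (H.det_ne_zero y hy) k i j)

theorem coordDeriv_metric (H : IsPullbackMetric N ι G h) (hy : y ∈ N) (m i j : Fin n) :
    ((pderiv m (fun y => h y i j) y : ℝ) : ℂ)
      = Matrix.toLinearMap₂' ℂ (dirDeriv G (ι y) (coordDeriv m ι y)) (coordDeriv i ι y)
          (coordDeriv j ι y)
        + Matrix.toLinearMap₂' ℂ (G (ι y)) (coordDeriv m (coordDeriv i ι) y) (coordDeriv j ι y)
        + Matrix.toLinearMap₂' ℂ (G (ι y)) (coordDeriv i ι y)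
          (coordDeriv m (coordDeriv j ι) y) := by
  rw [ofReal_pderiv (H.analyticAt_metric hy i j).differentiableAt, ← coordDeriv_bilin
    (H.analytic y hy).differentiableAt (fun a b => (H.holomorphic y hy a b).differentiableAt)
    (analyticAt_coordDeriv (H.analytic y hy) i).differentiableAt
    (analyticAt_coordDeriv (H.analytic y hy) j).differentiableAt]
  refine coordDeriv_congr ?_ m
  filter_upwards [H.isOpen.mem_nhds hy] with w hw
  exact H.eq_bilin hw i j

/-- The transformation law of the Christoffel symbols. -/
theorem connection_pullback (H : IsPullbackMetric N ι G h) (hy : y ∈ N) (i j : Fin n) :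
    ∑ k, ((christoffel h k i j y : ℝ) : ℂ) • coordDeriv k ι y
      = connection G (ι y) (coordDeriv i ι y) (coordDeriv j ι y)
        + coordDeriv i (coordDeriv j ι) y := by
  -- Tested against the m-th coordinate vector, both sides become Koszul expressions. The
  -- derivatives of `h` bring in second derivatives of `ι`, which cancel in pairs except for twice
  -- the product of ∂ₘι with ∂ᵢ∂ⱼι.
  refine H.ext_inner hy fun m => ?_
  have h1 : Matrix.toLinearMap₂' ℂ (G (ι y)) (coordDeriv m ι y)
      (∑ k, ((christoffel h k i j y : ℝ) : ℂ) • coordDeriv k ι y)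
        = ((∑ k, h y m k * christoffel h k i j y : ℝ) : ℂ) := by
    simp only [map_sum, map_smul, ← H.eq_bilin hy, smul_eq_mul]
    push_cast
    exact Finset.sum_congr rfl fun k _ => mul_comm _ _
  rw [h1, lower_christoffel (H.det_ne_zero y hy), map_add,
    inner_connection (H.isUnit hy).1.ne_zero]
  push_cast
  rw [H.coordDeriv_metric hy, H.coordDeriv_metric hy, H.coordDeriv_metric hy,
    coordDeriv_comm (H.analytic y hy) j i, coordDeriv_comm (H.analytic y hy) m i,
    coordDeriv_comm (H.analytic y hy) m j,
    H.bilin_comm hy (coordDeriv m ι y) (coordDeriv i (coordDeriv j ι) y),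
    H.bilin_comm hy (coordDeriv i (coordDeriv m ι) y) (coordDeriv j ι y)]
  ring

/-- The derivative of the transformation law of the Christoffel symbols. -/
theorem connectionDeriv_pullback (H : IsPullbackMetric N ι G h) (hy : y ∈ N) (c d b : Fin n) :
    ∑ k, ((pderiv c (christoffel h k d b) y : ℝ) : ℂ) • coordDeriv k ι y
      = connectionDeriv G (ι y) (coordDeriv c ι y) (coordDeriv d ι y) (coordDeriv b ι y)
        + connection G (ι y) (coordDeriv c (coordDeriv d ι) y) (coordDeriv b ι y)
        + connection G (ι y) (coordDeriv d ι y) (coordDeriv c (coordDeriv b ι) y)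
        + coordDeriv c (coordDeriv d (coordDeriv b ι)) y
        - ∑ k, ((christoffel h k d b y : ℝ) : ℂ) • coordDeriv c (coordDeriv k ι) y := by
  have hι := H.analytic y hy
  have hJ := fun i => analyticAt_coordDeriv hι i
  have hG : ∀ a p q, AnalyticAt ℂ (christoffel G a p q) (ι y) :=
    analyticAt_christoffel (H.holomorphic y hy) (H.isUnit hy).1.ne_zero
  have hΓ : HasFDerivAt (fun w => connection G (ι w) (coordDeriv d ι w) (coordDeriv b ι w))
      (fderiv ℝ (fun w => connection G (ι w) (coordDeriv d ι w) (coordDeriv b ι w)) y) y := by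
    refine DifferentiableAt.hasFDerivAt (differentiableAt_pi.2 fun a => ?_)
    simp only [connection, Matrix.toLinearMap₂'_apply, Matrix.of_apply, smul_eq_mul]
    refine DifferentiableAt.fun_sum fun p _ => DifferentiableAt.fun_sum fun q _ => ?_
    exact (differentiableAt_pi.1 (hJ d).differentiableAt p).mul
      ((differentiableAt_pi.1 (hJ b).differentiableAt q).mul
        (((hG a p q).differentiableAt.restrictScalars ℝ).comp y hι.differentiableAt))
  have hlhs := coordDeriv_sum_smul (i := c) Finset.univ
    (fun k _ => (H.analyticAt_ofReal_christoffel hy k d b).differentiableAt)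
    (fun k _ => (hJ k).differentiableAt)
  -- The transformation law holds throughout the open set `N`, so it may be differentiated.
  have hrhs : coordDeriv c (fun w => ∑ k, ((christoffel h k d b w : ℝ) : ℂ) • coordDeriv k ι w) y
      = coordDeriv c (fun w => connection G (ι w) (coordDeriv d ι w) (coordDeriv b ι w)) y
        + coordDeriv c (coordDeriv d (coordDeriv b ι)) y := by
    rw [← coordDeriv_add hΓ.differentiableAt (analyticAt_coordDeriv (hJ b) d).differentiableAt]
    refine coordDeriv_congr ?_ c
    filter_upwards [H.isOpen.mem_nhds hy] with w hw
    exact H.connection_pullback hw d b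
  have hconn : coordDeriv c (fun w => connection G (ι w) (coordDeriv d ι w) (coordDeriv b ι w)) y
      = connectionDeriv G (ι y) (coordDeriv c ι y) (coordDeriv d ι y) (coordDeriv b ι y)
        + connection G (ι y) (coordDeriv c (coordDeriv d ι) y) (coordDeriv b ι y)
        + connection G (ι y) (coordDeriv d ι y) (coordDeriv c (coordDeriv b ι) y) := by
    ext a
    have := coordDeriv_bilin (M := fun x => Matrix.of fun p q => christoffel G a p q x)
      hι.differentiableAt (fun p q => (hG a p q).differentiableAt) (hJ d).differentiableAt
      (hJ b).differentiableAt c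
    simp only [Pi.add_apply]
    refine Eq.trans ?_ this
    exact (congrArg (fun L : (Fin n → ℝ) →L[ℝ] ℂ => L (Pi.single c 1))
      (hasFDerivAt_pi'.1 hΓ a).fderiv).symm
  have hp : ∀ k, ((pderiv c (christoffel h k d b) y : ℝ) : ℂ)
      = coordDeriv c (fun y => ((christoffel h k d b y : ℝ) : ℂ)) y := fun k =>
    ofReal_pderiv (analyticAt_christoffel (H.analyticAt_metric hy) (H.det_ne_zero y hy)
      k d b).differentiableAt c
  rw [← hconn, ← hrhs, hlhs, Finset.sum_add_distrib, add_sub_cancel_right]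
  simp only [hp]

theorem connection_add_sum (c : Fin n → ℂ) (X : Fin n → ℂ) (z : Fin n → ℂ)
    (Y : Fin n → Fin n → ℂ) :
    connection G z X (∑ e, c e • Y e) = ∑ e, c e • connection G z X (Y e) := by
  ext a
  simp [connection, map_sum]

/-- The transformation law of the curvature tensor. -/
theorem curvature_pullback (H : IsPullbackMetric N ι G h) (hy : y ∈ N) (b c d : Fin n) :
    ∑ k, ((riemannUp h y k b c d : ℝ) : ℂ) • coordDeriv k ι y
      = curvature G (ι y) (coordDeriv b ι y) (coordDeriv c ι y) (coordDeriv d ι y) := by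
  have hι := H.analytic y hy
  have quad : ∀ c d, ∑ k, (∑ e, ((christoffel h k c e y : ℝ) : ℂ) * ((christoffel h e d b y : ℝ) : ℂ))
        • coordDeriv k ι y
      = connection G (ι y) (coordDeriv c ι y)
          (connection G (ι y) (coordDeriv d ι y) (coordDeriv b ι y))
        + connection G (ι y) (coordDeriv c ι y) (coordDeriv d (coordDeriv b ι) y)
        + ∑ e, ((christoffel h e d b y : ℝ) : ℂ) • coordDeriv c (coordDeriv e ι) y := by
    intro c d
    have hadd : ∀ X Y Z : Fin n → ℂ, connection G (ι y) X Y + connection G (ι y) X Z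
        = connection G (ι y) X (Y + Z) := by
      intro X Y Z
      ext a
      simp [connection]
    rw [hadd, ← H.connection_pullback hy, connection_add_sum, ← Finset.sum_add_distrib]
    simp only [Finset.sum_smul]
    rw [Finset.sum_comm]
    refine Finset.sum_congr rfl fun e _ => ?_
    rw [← smul_add, ← H.connection_pullback hy, Finset.smul_sum]
    refine Finset.sum_congr rfl fun k _ => ?_
    rw [smul_smul, mul_comm]
  have hR : ∑ k, ((riemannUp h y k b c d : ℝ) : ℂ) • coordDeriv k ι y
      = (∑ k, ((pderiv c (christoffel h k d b) y : ℝ) : ℂ) • coordDeriv k ι y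
        + ∑ k, (∑ e, ((christoffel h k c e y : ℝ) : ℂ) * ((christoffel h e d b y : ℝ) : ℂ))
          • coordDeriv k ι y)
        - (∑ k, ((pderiv d (christoffel h k c b) y : ℝ) : ℂ) • coordDeriv k ι y
        + ∑ k, (∑ e, ((christoffel h k d e y : ℝ) : ℂ) * ((christoffel h e c b y : ℝ) : ℂ))
          • coordDeriv k ι y) := by
    rw [← Finset.sum_add_distrib, ← Finset.sum_add_distrib, ← Finset.sum_sub_distrib]
    refine Finset.sum_congr rfl fun k _ => ?_
    rw [← add_smul, ← add_smul, ← sub_smul, riemannUp, Finset.sum_sub_distrib]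
    push_cast
    congr 1
    ring
  -- The sums of Christoffel symbols of `h` times second derivatives of `ι` cancel between the
  -- linear and quadratic parts. The other inhomogeneous terms are symmetric in c and d, and drop
  -- out on antisymmetrization.
  rw [hR, quad, quad, H.connectionDeriv_pullback hy, H.connectionDeriv_pullback hy, curvature_eq,
    coordDeriv_comm hι d c, coordDeriv_comm (analyticAt_coordDeriv hι b) d c]
  abel

end IsPullbackMetric

end Slice

/-! ### Components of tensors of rank two and four -/

section Components

variable {K : Type*} [Field K] {n k : ℕ}

theorem sum_fin_succ_arrow {α R : Type*} [Fintype α] [AddCommMonoid R]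
    (F : (Fin (k + 1) → α) → R) :
    ∑ J, F J = ∑ a, ∑ J : Fin k → α, F (Fin.cons a J) := by
  rw [← Fintype.sum_prod_type', ← Equiv.sum_comp (Fin.consEquiv fun _ : Fin (k + 1) => α)]
  rfl

theorem tensorMap_two (T : Fin n → Fin n → K) (v : Fin 2 → Fin n → K) :
    tensorMap (fun I => T (I 0) (I 1)) v = ∑ a, ∑ b, v 0 a * v 1 b * T a b := by
  rw [tensorMap_apply]
  simp [sum_fin_succ_arrow, Fin.prod_univ_succ]

theorem tensorMap_four (T : Fin n → Fin n → Fin n → Fin n → K) (v : Fin 4 → Fin n → K) :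
    tensorMap (fun I => T (I 0) (I 1) (I 2) (I 3)) v
      = ∑ a, ∑ b, ∑ c, ∑ d, v 0 a * v 1 b * v 2 c * v 3 d * T a b c d := by
  rw [tensorMap_apply]
  simp only [sum_fin_succ_arrow, Fintype.sum_unique, Fin.prod_univ_four]
  rfl

theorem sum_mul_sum_cross (g r : Fin n → Fin n → K) (X Y Z W : Fin n → K) :
    ∑ a, ∑ b, ∑ c, ∑ d, X a * Y b * Z c * W d * (g a c * r b d)
      = (∑ a, ∑ c, X a * Z c * g a c) * (∑ b, ∑ d, Y b * W d * r b d) := by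
  simp only [Finset.sum_mul]
  simp only [Finset.mul_sum]
  refine Finset.sum_congr rfl fun a _ => ?_
  rw [Finset.sum_comm]
  refine Finset.sum_congr rfl fun c _ => Finset.sum_congr rfl fun b _ =>
    Finset.sum_congr rfl fun d _ => ?_
  ring

theorem sum_mul_sum_nested (g r : Fin n → Fin n → K) (X Y Z W : Fin n → K) :
    ∑ a, ∑ b, ∑ c, ∑ d, X a * Y b * Z c * W d * (g a d * r b c)
      = (∑ a, ∑ d, X a * W d * g a d) * (∑ b, ∑ c, Y b * Z c * r b c) := by
  rw [← sum_mul_sum_cross g r X Y W Z]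
  refine Finset.sum_congr rfl fun a _ => Finset.sum_congr rfl fun b _ => ?_
  rw [Finset.sum_comm]
  refine Finset.sum_congr rfl fun c _ => Finset.sum_congr rfl fun d _ => ?_
  ring

end Components

/-! ### The Riemann, Ricci and Weyl tensors as pullbacks -/

namespace IsPullbackMetric

variable {n : ℕ} {N : Set (Fin n → ℝ)} {ι : (Fin n → ℝ) → Fin n → ℂ}
  {G : (Fin n → ℂ) → Matrix (Fin n) (Fin n) ℂ} {h : (Fin n → ℝ) → Matrix (Fin n) (Fin n) ℝ}
  {y : Fin n → ℝ}

theorem riemann_pullback (H : IsPullbackMetric N ι G h) (hy : y ∈ N) (a b c d : Fin n) :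
    ((riemann h y a b c d : ℝ) : ℂ)
      = ∑ p, ∑ q, ∑ r, ∑ s, coordDeriv a ι y p * coordDeriv b ι y q * coordDeriv c ι y r
          * coordDeriv d ι y s * riemann G (ι y) p q r s := by
  have h1 : ((riemann h y a b c d : ℝ) : ℂ)
      = Matrix.toLinearMap₂' ℂ (G (ι y)) (coordDeriv a ι y)
        (∑ k, ((riemannUp h y k b c d : ℝ) : ℂ) • coordDeriv k ι y) := by
    simp only [map_sum, map_smul, ← H.eq_bilin hy, smul_eq_mul, riemann]
    push_cast
    exact Finset.sum_congr rfl fun k _ => mul_comm _ _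
  rw [h1, H.curvature_pullback hy, Matrix.toLinearMap₂'_apply]
  refine Finset.sum_congr rfl fun p _ => ?_
  simp only [curvature, riemann, smul_eq_mul, Finset.sum_mul, Finset.mul_sum]
  rw [Finset.sum_comm]
  refine Finset.sum_congr rfl fun q _ => ?_
  rw [Finset.sum_comm]
  refine Finset.sum_congr rfl fun r _ => ?_
  rw [Finset.sum_comm]
  refine Finset.sum_congr rfl fun s _ => Finset.sum_congr rfl fun e _ => ?_
  ring

theorem ricci_pullback (H : IsPullbackMetric N ι G h) (hy : y ∈ N) (b d : Fin n) :
    ((ricci h y b d : ℝ) : ℂ)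
      = ∑ q, ∑ s, coordDeriv b ι y q * coordDeriv d ι y s * ricci G (ι y) q s := by
  set J := jacobian ι y with hJ
  have hu : IsUnit J.det := (H.isUnit hy).2
  let P : Matrix (Fin n) (Fin n) ℂ := Matrix.of fun k c => ((riemannUp h y k b c d : ℝ) : ℂ)
  let Q : Matrix (Fin n) (Fin n) ℂ := Matrix.of fun a r =>
    ∑ q, ∑ s, coordDeriv b ι y q * coordDeriv d ι y s * riemannUp G (ι y) a q r s
  -- For fixed b and d the curvature is an endomorphism whose trace is the Ricci component. The
  -- transformation law makes the two endomorphisms similar via J, so their traces agree.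
  have hPQ : J * P = Q * J := by
    ext a c
    have := congrFun (H.curvature_pullback hy b c d) a
    rw [Finset.sum_apply] at this
    simp only [Matrix.mul_apply, P, Q, hJ, jacobian, Matrix.of_apply]
    have h2 : ∑ k, coordDeriv k ι y a * ((riemannUp h y k b c d : ℝ) : ℂ)
        = ∑ k, (((riemannUp h y k b c d : ℝ) : ℂ) • coordDeriv k ι y) a :=
      Finset.sum_congr rfl fun k _ => mul_comm _ _
    rw [h2, this]
    simp only [curvature, Finset.sum_mul]
    rw [Finset.sum_comm]
    refine Finset.sum_congr rfl fun r _ => Finset.sum_congr rfl fun q _ =>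
      Finset.sum_congr rfl fun s _ => ?_
    ring
  have hP : P = J⁻¹ * (Q * J) := by
    rw [← hPQ, ← Matrix.mul_assoc, Matrix.nonsing_inv_mul _ hu, Matrix.one_mul]
  have htr : P.trace = Q.trace := by
    rw [hP, Matrix.trace_mul_comm, Matrix.mul_assoc, Matrix.mul_nonsing_inv _ hu, Matrix.mul_one]
  have hl : ((ricci h y b d : ℝ) : ℂ) = P.trace := by
    simp [ricci, Matrix.trace, P]
  rw [hl, htr]
  simp only [Matrix.trace, Matrix.diag, Q, ricci, Matrix.of_apply, Finset.mul_sum]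
  rw [Finset.sum_comm]
  refine Finset.sum_congr rfl fun q _ => ?_
  rw [Finset.sum_comm]

theorem ricciScalar_pullback (H : IsPullbackMetric N ι G h) (hy : y ∈ N) :
    ((ricciScalar h y : ℝ) : ℂ) = ricciScalar G (ι y) := by
  set J := jacobian ι y with hJ
  have hu : IsUnit J.det := (H.isUnit hy).2
  have hut : IsUnit J.transpose.det := by rwa [Matrix.det_transpose]
  have hG : IsUnit (G (ι y)).det := (H.isUnit hy).1
  have hscalar : ∀ {𝕜 : Type} [RCLike 𝕜] (g : (Fin n → 𝕜) → Matrix (Fin n) (Fin n) 𝕜)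
      (x : Fin n → 𝕜), ricciScalar g x = ((g x)⁻¹ * (Matrix.of (ricci g x)).transpose).trace := by
    intro 𝕜 _ g x
    simp [ricciScalar, Matrix.trace, Matrix.mul_apply]
  have hric : (Matrix.of (ricci h y)).map Complex.ofReal
      = J.transpose * Matrix.of (ricci G (ι y)) * J := by
    ext b d
    rw [Matrix.map_apply, Matrix.of_apply, H.ricci_pullback hy]
    simp only [Matrix.mul_apply, Matrix.transpose_apply, hJ, jacobian, Finset.sum_mul,
      Matrix.of_apply]
    rw [Finset.sum_comm]
    refine Finset.sum_congr rfl fun q _ => Finset.sum_congr rfl fun s _ => ?_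
    ring
  -- The inverse metric transforms contragrediently, so every Jacobian cancels under the trace.
  have hinv : ((h y)⁻¹).map Complex.ofReal = J⁻¹ * (G (ι y))⁻¹ * (J.transpose)⁻¹ := by
    have h1 : ((h y)⁻¹).map Complex.ofReal = ((h y).map Complex.ofReal)⁻¹ := by
      symm
      refine Matrix.inv_eq_right_inv ?_
      have h2 := Matrix.mul_nonsing_inv (h y) (H.det_ne_zero y hy).isUnit
      have h3 := congrArg Complex.ofRealHom.mapMatrix h2
      rw [map_mul, map_one] at h3
      exact h3
    rw [h1, H.eq_mul hy, Matrix.mul_inv_rev, Matrix.mul_inv_rev, Matrix.mul_assoc]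
  have hcast : ((ricciScalar h y : ℝ) : ℂ)
      = (((h y)⁻¹).map Complex.ofReal
        * ((Matrix.of (ricci h y)).map Complex.ofReal).transpose).trace := by
    rw [hscalar]
    simp [Matrix.trace, Matrix.mul_apply]
  rw [hcast, hric, hinv, hscalar, Matrix.transpose_mul, Matrix.transpose_mul,
    Matrix.transpose_transpose, Matrix.mul_assoc, Matrix.mul_assoc, Matrix.trace_mul_comm]
  congr 1
  simp only [Matrix.mul_assoc]
  rw [Matrix.nonsing_inv_mul_cancel_left _ _ hut, Matrix.mul_nonsing_inv _ hu, Matrix.mul_one]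

theorem weyl_pullback (H : IsPullbackMetric N ι G h) (hy : y ∈ N) (a b c d : Fin n) :
    ((weyl h y a b c d : ℝ) : ℂ)
      = ∑ p, ∑ q, ∑ r, ∑ s, coordDeriv a ι y p * coordDeriv b ι y q * coordDeriv c ι y r
          * coordDeriv d ι y s * weyl G (ι y) p q r s := by
  by_cases hn : n < 3
  · simp [weyl, hn]
  have hg : ∀ i j, ((h y i j : ℝ) : ℂ)
      = ∑ p, ∑ q, coordDeriv i ι y p * coordDeriv j ι y q * G (ι y) p q := by
    intro i j
    rw [H.eq_bilin hy, Matrix.toLinearMap₂'_apply]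
    simp only [smul_eq_mul, mul_assoc]
  simp only [weyl, if_neg hn]
  push_cast
  rw [H.riemann_pullback hy, H.ricciScalar_pullback hy]
  set α : ℂ := ((n : ℂ) - 2)⁻¹
  set β : ℂ := (((n : ℂ) - 1) * ((n : ℂ) - 2))⁻¹ * ricciScalar G (ι y)
  -- Splits the Weyl tensor so that every correction term is a product of two rank-two contractions,
  -- whose pullbacks are known.
  have hexp : ∀ (X Y Z W : Fin n → ℂ), ∑ p, ∑ q, ∑ r, ∑ s, X p * Y q * Z r * W s *
      (riemann G (ι y) p q r s - α * (G (ι y) p r * ricci G (ι y) q s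
          - G (ι y) p s * ricci G (ι y) q r
          + G (ι y) q s * ricci G (ι y) p r - G (ι y) q r * ricci G (ι y) p s)
        + β * (G (ι y) p r * G (ι y) q s - G (ι y) p s * G (ι y) q r))
      = ∑ p, ∑ q, ∑ r, ∑ s, X p * Y q * Z r * W s * riemann G (ι y) p q r s
        - α * (∑ p, ∑ q, ∑ r, ∑ s, X p * Y q * Z r * W s * (G (ι y) p r * ricci G (ι y) q s)
          - ∑ p, ∑ q, ∑ r, ∑ s, X p * Y q * Z r * W s * (G (ι y) p s * ricci G (ι y) q r)
          + ∑ p, ∑ q, ∑ r, ∑ s, X p * Y q * Z r * W s * (ricci G (ι y) p r * G (ι y) q s)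
          - ∑ p, ∑ q, ∑ r, ∑ s, X p * Y q * Z r * W s * (ricci G (ι y) p s * G (ι y) q r))
        + β * (∑ p, ∑ q, ∑ r, ∑ s, X p * Y q * Z r * W s * (G (ι y) p r * G (ι y) q s)
          - ∑ p, ∑ q, ∑ r, ∑ s, X p * Y q * Z r * W s * (G (ι y) p s * G (ι y) q r)) := by
    intro X Y Z W
    simp only [Finset.mul_sum, ← Finset.sum_add_distrib, ← Finset.sum_sub_distrib]
    refine Finset.sum_congr rfl fun p _ => Finset.sum_congr rfl fun q _ =>
      Finset.sum_congr rfl fun r _ => Finset.sum_congr rfl fun s _ => ?_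
    ring
  rw [hexp, sum_mul_sum_cross (G (ι y)) (ricci G (ι y)), sum_mul_sum_nested (G (ι y)) (ricci G (ι y)),
    sum_mul_sum_cross (ricci G (ι y)) (G (ι y)), sum_mul_sum_nested (ricci G (ι y)) (G (ι y)),
    sum_mul_sum_cross (G (ι y)) (G (ι y)), sum_mul_sum_nested (G (ι y)) (G (ι y))]
  simp only [← hg, ← H.ricci_pullback hy]
  ring

end IsPullbackMetric

/-! ### Comparison of two slices through a common point -/

section TwoSlices

variable {n k : ℕ} {N N' : Set (Fin n → ℝ)} {ι ι' : (Fin n → ℝ) → Fin n → ℂ}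
  {G : (Fin n → ℂ) → Matrix (Fin n) (Fin n) ℂ} {h h' : (Fin n → ℝ) → Matrix (Fin n) (Fin n) ℝ}
  {y y' : Fin n → ℝ}

/-- A tensor of a metric that has a definite metric on another slice of its complexification is
not of proper type N, III or II. -/
theorem IsPullbackMetric.not_isProperlySpecial (H : IsPullbackMetric N ι G h)
    (H' : IsPullbackMetric N' ι' G h') (hy : y ∈ N) (hy' : y' ∈ N') (hyy : ι y = ι' y')
    (hdef : (h' y').PosDef ∨ (-(h' y')).PosDef) {T S : (Fin k → Fin n) → ℝ}
    {Q : (Fin k → Fin n) → ℂ}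
    (hT : ∀ I, (T I : ℂ) = tensorMap Q (fun r => coordDeriv (I r) ι y))
    (hS : ∀ I, (S I : ℂ) = tensorMap Q (fun r => coordDeriv (I r) ι' y')) :
    ¬ IsProperlySpecial (h y) T := by
  set J := jacobian ι y with hJ
  set J' := jacobian ι' y' with hJ'
  have hu : IsUnit J.det := (H.isUnit hy).2
  have hu' : IsUnit J'.det := (H'.isUnit hy').2
  have hJA : J * (J⁻¹ * J') = J' := by
    rw [← Matrix.mul_assoc, Matrix.mul_nonsing_inv _ hu, Matrix.one_mul]
  -- J⁻¹J' expresses the coordinate vectors of the definite slice in those of the other slice, with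
  -- complex coefficients.
  refine Spacetime.not_isProperlySpecial (H.symm y hy) hdef (A := J⁻¹ * J') ?_ ?_ (S := S) ?_
  · rw [Matrix.det_mul]
    exact (Matrix.isUnit_nonsing_inv_det _ hu).mul hu'
  · rw [H.eq_mul hy, H'.eq_mul hy', ← hJ, ← hJ', hyy]
    calc (J⁻¹ * J').transpose * (J.transpose * G (ι' y') * J) * (J⁻¹ * J')
        = (J * (J⁻¹ * J')).transpose * G (ι' y') * (J * (J⁻¹ * J')) := by
          rw [Matrix.transpose_mul J]
          simp only [Matrix.mul_assoc]
      _ = J'.transpose * G (ι' y') * J' := by rw [hJA]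
  · intro I
    have hT' : ∀ I, (T I : ℂ) = tensorMap Q (fun r => J.mulVec (Pi.single (I r) 1)) := by
      intro I
      rw [hT]
      simp only [hJ, jacobian_mulVec_single]
    rw [tensorMap_pullback hT', hS]
    simp only [Matrix.mulVec_mulVec, hJA]
    simp only [hJ', jacobian_mulVec_single]

theorem IsPullbackMetric.not_special (H : IsPullbackMetric N ι G h)
    (H' : IsPullbackMetric N' ι' G h') (hy : y ∈ N) (hy' : y' ∈ N') (hyy : ι y = ι' y')
    (hdef : (h' y').PosDef ∨ (-(h' y')).PosDef) :
    ¬ IsProperlySpecial (h y)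
        (fun I : Fin 4 → Fin n => weyl h y (I 0) (I 1) (I 2) (I 3)) ∧
      ¬ IsProperlySpecial (h y) (fun I : Fin 2 → Fin n => ricci h y (I 0) (I 1)) ∧
      ¬ IsProperlySpecial (h y)
        (fun I : Fin 4 → Fin n => riemann h y (I 0) (I 1) (I 2) (I 3)) := by
  refine ⟨?_, ?_, ?_⟩
  · refine H.not_isProperlySpecial H' hy hy' hyy hdef
      (S := fun I : Fin 4 → Fin n => weyl h' y' (I 0) (I 1) (I 2) (I 3))
      (Q := fun I : Fin 4 → Fin n => weyl G (ι y) (I 0) (I 1) (I 2) (I 3)) (fun I => ?_) fun I => ?_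
    · rw [tensorMap_four, H.weyl_pullback hy]
    · rw [tensorMap_four, H'.weyl_pullback hy', hyy]
  · refine H.not_isProperlySpecial H' hy hy' hyy hdef
      (S := fun I : Fin 2 → Fin n => ricci h' y' (I 0) (I 1))
      (Q := fun I : Fin 2 → Fin n => ricci G (ι y) (I 0) (I 1)) (fun I => ?_) fun I => ?_
    · rw [tensorMap_two, H.ricci_pullback hy]
    · rw [tensorMap_two, H'.ricci_pullback hy', hyy]
  · refine H.not_isProperlySpecial H' hy hy' hyy hdef
      (S := fun I : Fin 4 → Fin n => riemann h' y' (I 0) (I 1) (I 2) (I 3))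
      (Q := fun I : Fin 4 → Fin n => riemann G (ι y) (I 0) (I 1) (I 2) (I 3))
      (fun I => ?_) fun I => ?_
    · rw [tensorMap_four, H.riemann_pullback hy]
    · rw [tensorMap_four, H'.riemann_pullback hy', hyy]

theorem isPullbackMetric_of_isRealSlice {a : Fin n → ℝ} {W : Set (Fin n → ℂ)}
    (hG : ∀ i j, AnalyticOnNhd ℂ (fun z => G z i j) W) (hι : IsRealSlice a W N ι)
    (hpull : ∀ y ∈ N, ∀ i j, (h y i j : ℂ) = pullback G ι y i j)
    (hdet : ∀ y ∈ N, (h y).det ≠ 0) (hR : IsRiemannianOn N h) : IsPullbackMetric N ι G h where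
  isOpen := hι.isOpen
  analytic := hι.analytic
  holomorphic y hy a b := hG a b _ (hι.mapsTo hy)
  symm y hy := by
    rcases hR with hR | hR
    · simpa [Matrix.IsSymm, Matrix.IsHermitian, Matrix.conjTranspose_eq_transpose_of_trivial]
        using (hR y hy).isHermitian
    · simpa [Matrix.IsSymm, Matrix.IsHermitian, Matrix.conjTranspose_eq_transpose_of_trivial]
        using (hR y hy).isHermitian
  det_ne_zero := hdet
  eq_pullback := hpull

/-- A vector in the kernel has zero product with every frame vector, so its expansion vanishes. Each
special type supplies a null frame, hence nondegeneracy at the point. -/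
theorem det_ne_zero_of_isNullFrame {g : Matrix (Fin n) (Fin n) ℝ} (hg : g.IsSymm)
    {e : Fin n → Fin n → ℝ} {o o' : Fin n} (he : IsNullFrame g e o o') : g.det ≠ 0 := by
  obtain ⟨ε, -, hd⟩ := isDualFrame_of_isNullFrame hg he
  intro h0
  obtain ⟨v, hv0, hv⟩ := Matrix.exists_vecMul_eq_zero_iff.2 h0
  refine hv0 ?_
  rw [hd.expansion (by simp) v]
  refine Finset.sum_eq_zero fun j _ => ?_
  rw [Matrix.toLinearMap₂'_apply', Matrix.dotProduct_mulVec, hv]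
  simp

theorem IsProperlySpecial.exists_isNullFrame {g : Matrix (Fin n) (Fin n) ℝ}
    {T : (Fin k → Fin n) → ℝ} (hT : IsProperlySpecial g T) : ∃ e o o', IsNullFrame g e o o' := by
  rcases hT with ⟨-, e, o, o', he, -⟩ | ⟨⟨e, o, o', he, -⟩, -⟩ | ⟨⟨e, o, o', he, -⟩, -⟩ <;>
    exact ⟨e, o, o', he⟩

end TwoSlices

/-! ### The Lorentzian metric in two charts -/

section Charts

variable {n : ℕ} {M : Type*} [TopologicalSpace M] [ChartedSpace (Fin n → ℝ) M]

/-- Symmetry follows from the existence of an orthonormal basis: the Gram matrix in it is diagonal.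
-/
theorem LorentzianMetric.form_comm (g : LorentzianMetric n M) (p : M)
    (v w : TangentSpace 𝓘(ℝ, Fin n → ℝ) p) : g.form p v w = g.form p w v := by
  obtain ⟨b, i₀, ε, -, hb⟩ := g.lorentzian p
  have : g.form p = (g.form p).flip := by
    refine b.ext fun i => b.ext fun j => ?_
    rw [LinearMap.flip_apply, hb, hb]
    by_cases hij : i = j
    · subst hij; rfl
    · rw [if_neg hij, if_neg (Ne.symm hij)]
  exact LinearMap.congr_fun (LinearMap.congr_fun this v) w

theorem LorentzianMetric.inChart_isSymm (g : LorentzianMetric n M)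
    (φ : OpenPartialHomeomorph M (Fin n → ℝ)) (x : Fin n → ℝ) : (g.inChart φ x).IsSymm := by
  ext i j
  exact g.form_comm _ _ _

/-- The inclusion of the real points as a continuous real linear map. -/
def toComplexCLM (n : ℕ) : (Fin n → ℝ) →L[ℝ] (Fin n → ℂ) :=
  ContinuousLinearMap.pi fun i => Complex.ofRealCLM.comp (ContinuousLinearMap.proj i)

variable {φ ψ : OpenPartialHomeomorph M (Fin n → ℝ)}

theorem analyticAt_transition (hφ : φ ∈ IsManifold.maximalAtlas 𝓘(ℝ, Fin n → ℝ) ω M)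
    (hψ : ψ ∈ IsManifold.maximalAtlas 𝓘(ℝ, Fin n → ℝ) ω M) {x : Fin n → ℝ}
    (hx : x ∈ (φ.symm.trans ψ).source) : AnalyticAt ℝ (fun x => ψ (φ.symm x)) x := by
  rw [OpenPartialHomeomorph.trans_source] at hx
  have h1 := (contMDiffOn_symm_of_mem_maximalAtlas hφ).contMDiffAt (φ.open_target.mem_nhds hx.1)
  have h2 := (contMDiffOn_of_mem_maximalAtlas hψ).contMDiffAt (ψ.open_source.mem_nhds hx.2)
  exact (h2.comp x h1).contDiffAt.analyticAt

/-- The transformation law of the metric components under a change of charts. -/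
theorem LorentzianMetric.inChart_transition (g : LorentzianMetric n M)
    (hφ : φ ∈ IsManifold.maximalAtlas 𝓘(ℝ, Fin n → ℝ) ω M)
    (hψ : ψ ∈ IsManifold.maximalAtlas 𝓘(ℝ, Fin n → ℝ) ω M) {x : Fin n → ℝ}
    (hx : x ∈ (φ.symm.trans ψ).source) (i j : Fin n) :
    g.inChart φ x i j = ∑ a, ∑ b, coordDeriv i (fun x => ψ (φ.symm x)) x a
      * coordDeriv j (fun x => ψ (φ.symm x)) x b * g.inChart ψ (ψ (φ.symm x)) a b := by
  set τ : (Fin n → ℝ) → Fin n → ℝ := fun x => ψ (φ.symm x) with hτ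
  have hτd : DifferentiableAt ℝ τ x := (analyticAt_transition hφ hψ hx).differentiableAt
  have hx' := hx
  rw [OpenPartialHomeomorph.trans_source] at hx'
  have hpt : ψ.symm (τ x) = φ.symm x := ψ.left_inv hx'.2
  have hev : φ.symm =ᶠ[nhds x] ψ.symm ∘ τ := by
    filter_upwards [(φ.symm.trans ψ).open_source.mem_nhds hx] with w hw
    rw [OpenPartialHomeomorph.trans_source] at hw
    exact (ψ.left_inv hw.2).symm
  have hψd : MDifferentiableAt 𝓘(ℝ, Fin n → ℝ) 𝓘(ℝ, Fin n → ℝ) ψ.symm (τ x) :=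
    ((contMDiffOn_symm_of_mem_maximalAtlas hψ).contMDiffAt
      (ψ.open_target.mem_nhds (ψ.map_source hx'.2))).mdifferentiableAt (by simp)
  -- Replacing the tangent spaces by the model space allows the base point to be rewritten along
  -- `hpt` despite the dependent types.
  let form : M → (Fin n → ℝ) →ₗ[ℝ] (Fin n → ℝ) →ₗ[ℝ] ℝ := g.form
  let D : (Fin n → ℝ) →L[ℝ] (Fin n → ℝ) :=
    mfderiv 𝓘(ℝ, Fin n → ℝ) 𝓘(ℝ, Fin n → ℝ) ψ.symm (τ x)
  let D' : (Fin n → ℝ) →L[ℝ] (Fin n → ℝ) :=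
    mfderiv 𝓘(ℝ, Fin n → ℝ) 𝓘(ℝ, Fin n → ℝ) φ.symm x
  have hD : D' = D.comp (fderiv ℝ τ x) := by
    have h1 : D' = mfderiv 𝓘(ℝ, Fin n → ℝ) 𝓘(ℝ, Fin n → ℝ) (ψ.symm ∘ τ) x := hev.mfderiv_eq
    rw [h1, ← mfderiv_eq_fderiv]
    exact mfderiv_comp x hψd hτd.mdifferentiableAt
  have hl : g.inChart φ x i j
      = form (φ.symm x) (D' (Pi.single i 1)) (D' (Pi.single j 1)) := rfl
  have hr : ∀ a b, g.inChart ψ (τ x) a b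
      = form (ψ.symm (τ x)) (D (Pi.single a 1)) (D (Pi.single b 1)) := fun a b => rfl
  have hexp : ∀ i, D' (Pi.single i 1) = ∑ a, coordDeriv i τ x a • D (Pi.single a 1) := by
    intro i
    have h1 : D' (Pi.single i 1) = D (coordDeriv i τ x) := by rw [hD]; rfl
    rw [h1]
    conv_lhs => rw [pi_eq_sum_univ' (coordDeriv i τ x)]
    simp [map_sum]
  rw [hl, hexp, hexp]
  change _ = ∑ a, ∑ b, coordDeriv i τ x a * coordDeriv j τ x b * g.inChart ψ (τ x) a b
  simp only [hr, hpt, map_sum, map_smul, LinearMap.sum_apply, LinearMap.smul_apply, smul_eq_mul,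
    Finset.mul_sum]
  rw [Finset.sum_comm]
  refine Finset.sum_congr rfl fun a _ => Finset.sum_congr rfl fun b _ => ?_
  ring

/-- Near a point at which it is nondegenerate, the metric read in one chart is a pullback of a
complexification of the metric read in another chart. -/
theorem LorentzianMetric.isPullbackMetric (g : LorentzianMetric n M)
    (hφ : φ ∈ IsManifold.maximalAtlas 𝓘(ℝ, Fin n → ℝ) ω M)
    (hψ : ψ ∈ IsManifold.maximalAtlas 𝓘(ℝ, Fin n → ℝ) ω M) {p : M} (hpφ : p ∈ φ.source)
    (hpψ : p ∈ ψ.source) {W : Set (Fin n → ℂ)} {gC : (Fin n → ℂ) → Matrix (Fin n) (Fin n) ℂ}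
    (hC : IsComplexification ψ.target (g.inChart ψ) (ψ p) W gC)
    (hdet : (g.inChart φ (φ p)).det ≠ 0) :
    ∃ N, φ p ∈ N ∧
      IsPullbackMetric N (fun x => toComplex (ψ (φ.symm x))) gC (g.inChart φ) := by
  set S := (φ.symm.trans ψ).source with hS
  have hpS : φ p ∈ S := by
    rw [hS, OpenPartialHomeomorph.trans_source]
    exact ⟨φ.map_source hpφ, by simpa [φ.left_inv hpφ] using hpψ⟩
  have hSt : S ⊆ φ.target := by
    rw [hS, OpenPartialHomeomorph.trans_source]
    exact Set.inter_subset_left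
  have hτ : ∀ x ∈ S, AnalyticAt ℝ (fun x => ψ (φ.symm x)) x := fun x hx =>
    analyticAt_transition hφ hψ hx
  have hι : ∀ x ∈ S, AnalyticAt ℝ (fun x => toComplex (ψ (φ.symm x))) x := fun x hx =>
    ((toComplexCLM n).analyticAt _).comp (hτ x hx)
  have hSo : IsOpen S := (φ.symm.trans ψ).open_source
  -- The neighbourhood is cut out by two open conditions: the image lies in the domain of the
  -- holomorphic metric, and the real metric is nondegenerate.
  have hN1 : IsOpen (S ∩ (fun x => toComplex (ψ (φ.symm x))) ⁻¹' W) :=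
    ContinuousOn.isOpen_inter_preimage
      (fun x hx => (hι x hx).continuousAt.continuousWithinAt) hSo hC.isOpen
  have hN2 : IsOpen (S ∩ (fun x => (g.inChart φ x).det) ⁻¹' {0}ᶜ) :=
    ContinuousOn.isOpen_inter_preimage
      (fun x hx => (analyticAt_det (𝕜 := ℝ) fun i j =>
        g.analytic φ hφ i j x (hSt hx)).continuousAt.continuousWithinAt) hSo isOpen_compl_singleton
  refine ⟨(S ∩ (fun x => toComplex (ψ (φ.symm x))) ⁻¹' W)
      ∩ (S ∩ (fun x => (g.inChart φ x).det) ⁻¹' {0}ᶜ), ⟨⟨hpS, ?_⟩, ⟨hpS, hdet⟩⟩,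
    hN1.inter hN2, fun x hx => hι x hx.1.1,
    fun x hx a b => hC.holomorphic a b _ hx.1.2, fun x _ => g.inChart_isSymm φ x,
    fun x hx => hx.2.2, fun x hx i j => ?_⟩
  · simpa [φ.left_inv hpφ] using hC.mem
  · have hxS : x ∈ S := hx.1.1
    have hder : ∀ i a, fderiv ℝ (fun x => toComplex (ψ (φ.symm x))) x (Pi.single i 1) a
        = ((coordDeriv i (fun x => ψ (φ.symm x)) x a : ℝ) : ℂ) := by
      intro i a
      have := ((toComplexCLM n).hasFDerivAt (x := ψ (φ.symm x))).comp x
        (hτ x hxS).differentiableAt.hasFDerivAt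
      have h2 : (fun x => toComplex (ψ (φ.symm x)))
        = (toComplexCLM n) ∘ fun x => ψ (φ.symm x) := rfl
      rw [h2, this.fderiv]
      rfl
    have hxt : ψ (φ.symm x) ∈ ψ.target := by
      rw [hS, OpenPartialHomeomorph.trans_source] at hxS
      exact ψ.map_source hxS.2
    rw [g.inChart_transition hφ hψ hxS, pullback]
    push_cast
    simp only [hder, hC.extends_real _ hxt hx.1.2]

end Charts

end Spacetime

end

theorem mainTheorem9 {n : ℕ} {M : Type*} [TopologicalSpace M] [ChartedSpace (Fin n → ℝ) M]
    [IsManifold 𝓘(ℝ, Fin n → ℝ) ω M] (g : Spacetime.LorentzianMetric n M) (p : M)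
    (h : g.IsWeylSpecialAt p ∨ g.IsRicciSpecialAt p ∨ g.IsRiemannSpecialAt p) :
    ¬ g.HasRiemannianExtensionAt p := by
  rintro ⟨ψ, hψ, hpψ, V, gbar, ⟨W, gC, ι, hC, hι, hpull, hdet⟩, hR⟩
  have H' := Spacetime.isPullbackMetric_of_isRealSlice hC.holomorphic hι hpull hdet hR
  have hdef : (gbar 0).PosDef ∨ (-(gbar 0)).PosDef :=
    hR.imp (fun hR => hR 0 hι.zero_mem) fun hR => hR 0 hι.zero_mem
  -- The chart φ that reads the type may differ from the chart ψ of the extension. Through the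
  -- transition map, the metric in φ becomes a slice metric of the same complexification, meeting
  -- the Riemannian slice at the complex point of `ψ p`.
  have key : ∀ φ ∈ IsManifold.maximalAtlas 𝓘(ℝ, Fin n → ℝ) ω M, p ∈ φ.source →
      (∃ e o o', Spacetime.IsNullFrame (g.inChart φ (φ p)) e o o') →
      ∃ N ι', φ p ∈ N ∧ Spacetime.IsPullbackMetric N ι' gC (g.inChart φ) ∧ ι' (φ p) = ι 0 := by
    rintro φ hφ hpφ ⟨e, o, o', he⟩
    obtain ⟨N, hpN, H⟩ := g.isPullbackMetric hφ hψ hpφ hpψ hC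
      (Spacetime.det_ne_zero_of_isNullFrame (g.inChart_isSymm φ _) he)
    exact ⟨N, _, hpN, H, by rw [hι.map_zero, φ.left_inv hpφ]⟩
  rcases h with ⟨φ, hφ, hpφ, hT⟩ | ⟨φ, hφ, hpφ, hT⟩ | ⟨φ, hφ, hpφ, hT⟩ <;>
    obtain ⟨N, ι', hpN, H, hp⟩ := key φ hφ hpφ hT.exists_isNullFrame
  · exact (H.not_special H' hpN hι.zero_mem hp hdef).1 hT
  · exact (H.not_special H' hpN hι.zero_mem hp hdef).2.1 hT
  · exact (H.not_special H' hpN hι.zero_mem hp hdef).2.2 hT
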